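/- **Setting.** Let $x_{t+1}=f(x_t,u_t,w_t)$ with $x_t\in\mathbb R^n$, $u_t\in\mathbb R^m$, $w_t\in\mathbb R^g$, $\|w_t\|\le w_{\max}$ (an arbitrary sequence fixed in advance), $x_0\neq0$, and let $\pi_1,\dots,\pi_N:\mathbb R^n\to\mathbb R^m$ be a pool of controllers. Assume: $\|f(x,u,w)-f(\tilde x,\tilde u,\tilde w)\|\le L_f(\|x-\tilde x\|+\|u-\tilde u\|+\|w-\tilde w\|)$ whenever $\|w\|,\|\tilde w\|\le w_{\max}$, with $L_f\ge1$, and $\|f(0,0,0)\|\le f_0$; the costs $c_t:\mathbb R^n\times\mathbb R^m\to\mathbb R$ (fixed in advance) are nonnegative, $|c_t(0,0)|\le c_{0,\max}$, and $|c_t(x,u)-c_t(\tilde x,\tilde u)|\le(L_{c1}(\max\{\|x\|,\|\tilde x\|\}+\max\{\|u\|,\|\tilde u\|\})+L_{c2})(\|x-\tilde x\|+\|u-\tilde u\|)$; every $\pi_i$ is $L_\pi$-Lipschitz with $\|\pi_i(0)\|\le\pi_{0,\max}$. Fix a non-increasing $\beta:\mathbb Z_{\ge0}\to\mathbb R$ with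 $\beta(0)=1$, $\beta(t)\to0$, and $\gamma>0$; put $H(t)=\sum_{i=0}^{t-1}\beta(i)$. A controller $\pi$ is *input-to-state stable* (ISS) if every sequence $x_{t+1}=f(x_t,\pi(x_t),w_t)$ with $\|w_t\|\le w_{\max}$ satisfies $\|x_t\|\le\beta(t)\|x_0\|+\gamma w_{\max}$ for all $t$, and *incrementally stable* if any two such sequences with the same $w$ satisfy $\|x_t-\tilde x_t\|\le\beta(t)\|x_0-\tilde x_0\|$. Let $\mathcal S$ be the set of controllers in the pool with both properties, assumed non-empty, and $\mathcal U$ the set of those that are not ISS. **Algorithm (DBAR with unknown $|\mathcal U|$, exponent $y=\tfrac12$).** Inputs: $\beta$, $\gamma$, batch lengths $(\tau_b)_{b\ge0}$, $\eta_0>0$, $\alpha_0>1$, $\delta\ge\gamma w_{\max}/(1-\beta(\tau_0))$. Start with $t_0=s_0=\mu_0=0$, $\mathcal P_0=\{1,\dots,N\}$, $W_0=0$. In batch $b=0,1,\dots$, as long as $t_b\le T$: sample $K_b$ from $p_b(k)=e^{-\eta_bW_b(k)}/\sum_{i\in\mathcal P_b}e^{-\eta_bW_b(i)}$, $k\in\mathcal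 P_b$, where $\eta_b=\eta_0(\mu_b+1)^{1/2}\alpha_b^{-2s_b}$. Use $\pi_{K_b}$ for $\tau_b$ rounds, but if $\|x_{t+1}\|>\beta(t+1-t_b)\|x_{t_b}\|+\gamma w_{\max}$ after some round $t$, stop the batch after that round and remove $K_b$ from the pool (falsification): $\mathcal P_{b+1}=\mathcal P_b\setminus\{K_b\}$, $\mu_{b+1}=\mu_b+1$; otherwise $\mathcal P_{b+1}=\mathcal P_b$, $\mu_{b+1}=\mu_b$. Let $t_{b+1}$ be the first round after the batch. If $\|x_{t_{b+1}}\|<\alpha_b\|x_0\|+\delta$, set $s_{b+1}=0$, $\alpha_{b+1}=\alpha_b$. Otherwise let $s\ge1$ be such that $\alpha_b^s\|x_0\|\le\|x_{t_{b+1}}\|-\delta<\alpha_b^{s+1}\|x_0\|$; if $s\le s_b+1$ set $s_{b+1}=s$, $\alpha_{b+1}=\alpha_b$, and if $s>s_b+1$ set $s_{b+1}=s_b+1$ and let $\alpha_{b+1}$ be any $\alpha>\alpha_b$ with $\alpha^{s_b+1}\|x_0\|\le\|x_{t_{b+1}}\|-\delta<\alpha^{s_b+2}\|x_0\|$. Finally,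 with $w_b(K_b)=\sum_{t=t_b}^{t_{b+1}-1}c_t(x_t,u_t)$, set $W_{b+1}(k)=W_b(k)+\frac{w_b(K_b)}{p_b(K_b)}\mathbf 1_{\{k=K_b\}}$ if $s_{b+1}=s_b$, and $W_{b+1}=0$ if $s_{b+1}\ne s_b$. The regret is $\mathrm{Regret}_T=\mathbb E\sum_{t=0}^T[c_t(x_t,u_t)-c_t(x_t^*,u_t^*)]$, where $(x_t^*,u_t^*)$ is generated from $x_0$ with the same disturbances by a controller in $\mathcal S$ with the least total cost over the rounds $0,\dots,T$. **Theorem.** Let $\tau_0=\lfloor(z/N)^{1/2}\rfloor$ and $\tau_b=\lceil((\nu b+z)/N)^{1/2}\rceil$ for $b\ge1$, where $\nu>0$ and $0<z\le\zeta N$ are such that $\tau_0>0$ and $\frac{\tau_1}{\tau_0}\beta(\tau_0)^2<\frac1{2\sqrt2}$. Let $\eta_0=\Theta(T^{-2/3}N^{-1/3})$, i.e. $\underline\eta\,T^{-2/3}N^{-1/3}\le\eta_0\le\overline\eta\,T^{-2/3}N^{-1/3}$ with constants $\underline\eta,\overline\eta>0$, and let $T\ge\max\Big\{\frac{|\mathcal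 U|^{3/2}}{N^{1/2}(|\mathcal U|+1)^{3/4}},\,N\Big\}$. Then $$\mathrm{Regret}_T\le\tilde O\big(T^{2/3}N^{1/3}(|\mathcal U|+1)^{1/2}\big)+o(1)\exp(O(|\mathcal U|))(|\mathcal U|+1)^{1/2}+o(T),$$ and if moreover $H(t)\le C_H\sum_{i=1}^t\frac1i$ for all $t\ge1$ with a constant $C_H$, then $$\mathrm{Regret}_T\le\Big[\tilde O(T^{2/3})+\tilde O(T^{-1/3})\exp(O(|\mathcal U|))\Big]N^{1/3}(|\mathcal U|+1)^{1/2}.$$ Here $\tilde O(\cdot)$ hides a constant factor and a power of $1+\log T$; all hidden constants depend only on $L_f,f_0,L_{c1},L_{c2},c_{0,\max},L_\pi,\pi_{0,\max},w_{\max},\beta,\gamma,\|x_0\|,\alpha_0,\delta,\nu,\zeta,\underline\eta,\overline\eta,C_H$; and $o(1)$, $o(T)$ refer to $T\to\infty$ with $N$ and these parameters fixed, uniformly in everything else. -/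

import Mathlib

open MeasureTheory Filter Topology

namespace DBAR

/-! ### The control problem -/

/-- `ℝ^d` with its Euclidean norm. -/
abbrev Vec (d : ℕ) : Type := EuclideanSpace ℝ (Fin d)

/-- The closed-loop sequence `x_0 = x`, `x_{t+1} = f (x_t, ctrl x_t, w_t)`. -/
def closedLoop {n m g : ℕ} (f : Vec n → Vec m → Vec g → Vec n) (ctrl : Vec n → Vec m)
    (w : ℕ → Vec g) (x : Vec n) : ℕ → Vec n
  | 0 => x
  | t + 1 => f (closedLoop f ctrl w x t) (ctrl (closedLoop f ctrl w x t)) (w t)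

/-- The decay functions `β` admitted in the stability notions. -/
def IsDecayRate (β : ℕ → ℝ) : Prop :=
  Antitone β ∧ β 0 = 1 ∧ Tendsto β atTop (𝓝 0)

/-- `H(t) = ∑_{i=0}^{t-1} β(i)`. -/
def decaySum (β : ℕ → ℝ) (t : ℕ) : ℝ := ∑ i ∈ Finset.range t, β i

/-- (Asymptotic) input-to-state stability of a controller, with decay `β` and gain `γ`. -/
def IsISS {n m g : ℕ} (f : Vec n → Vec m → Vec g → Vec n) (wmax : ℝ) (β : ℕ → ℝ) (γ : ℝ)
    (ctrl : Vec n → Vec m) : Prop :=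
  ∀ (x : Vec n) (w : ℕ → Vec g), (∀ t, ‖w t‖ ≤ wmax) →
    ∀ t, ‖closedLoop f ctrl w x t‖ ≤ β t * ‖x‖ + γ * wmax

/-- (Asymptotic) incremental stability of a controller, with decay `β`. -/
def IsIncrStable {n m g : ℕ} (f : Vec n → Vec m → Vec g → Vec n) (wmax : ℝ) (β : ℕ → ℝ)
    (ctrl : Vec n → Vec m) : Prop :=
  ∀ (x x' : Vec n) (w : ℕ → Vec g), (∀ t, ‖w t‖ ≤ wmax) →
    ∀ t, ‖closedLoop f ctrl w x t - closedLoop f ctrl w x' t‖ ≤ β t * ‖x - x'‖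

/-- The data of an online control problem with a pool of `N` candidate controllers: dynamics,
controllers, cost functions, disturbances, bound on the disturbances, starting state. -/
structure Problem (n m g N : ℕ) where
  f : Vec n → Vec m → Vec g → Vec n
  ctrl : Fin N → Vec n → Vec m
  cost : ℕ → Vec n → Vec m → ℝ
  noise : ℕ → Vec g
  wmax : ℝ
  x0 : Vec n

namespace Problem

variable {n m g N : ℕ}

/-- The disturbances lie in the ball of radius `wmax`. -/
def BoundedNoise (S : Problem n m g N) : Prop := ∀ t, ‖S.noise t‖ ≤ S.wmax

/-- The dynamics are `Lf`-Lipschitz (for disturbances in the ball), and `‖f(0,0,0)‖ ≤ f0`. -/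
def DynamicsAssumption (S : Problem n m g N) (Lf f0 : ℝ) : Prop :=
  (∀ x x' u u' w w', ‖w‖ ≤ S.wmax → ‖w'‖ ≤ S.wmax →
    ‖S.f x u w - S.f x' u' w'‖ ≤ Lf * (‖x - x'‖ + ‖u - u'‖ + ‖w - w'‖)) ∧
  ‖S.f 0 0 0‖ ≤ f0

/-- The costs are nonnegative, locally Lipschitz with linearly growing constant, and bounded at
the origin. -/
def CostAssumption (S : Problem n m g N) (Lc1 Lc2 c0max : ℝ) : Prop :=
  (∀ t x u, 0 ≤ S.cost t x u) ∧
  (∀ t x x' u u', |S.cost t x u - S.cost t x' u'| ≤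
    (Lc1 * (max ‖x‖ ‖x'‖ + max ‖u‖ ‖u'‖) + Lc2) * (‖x - x'‖ + ‖u - u'‖)) ∧
  (∀ t, |S.cost t 0 0| ≤ c0max)

/-- All candidate controllers are `Lctrl`-Lipschitz and bounded by `ctrl0max` at the origin. -/
def PoolAssumption (S : Problem n m g N) (Lctrl ctrl0max : ℝ) : Prop :=
  (∀ i, ‖S.ctrl i 0‖ ≤ ctrl0max) ∧
  (∀ i x x', ‖S.ctrl i x - S.ctrl i x'‖ ≤ Lctrl * ‖x - x'‖)

/-- The stabilizing controllers `𝒮`: both input-to-state stable and incrementally stable. -/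
def stabilizing (S : Problem n m g N) (β : ℕ → ℝ) (γ : ℝ) : Set (Fin N) :=
  {i | IsISS S.f S.wmax β γ (S.ctrl i) ∧ IsIncrStable S.f S.wmax β (S.ctrl i)}

/-- The destabilizing controllers `𝒰`: those that are not input-to-state stable. -/
def destabilizing (S : Problem n m g N) (β : ℕ → ℝ) (γ : ℝ) : Set (Fin N) :=
  {i | ¬ IsISS S.f S.wmax β γ (S.ctrl i)}

/-- The state at time `t` when controller `i` is used all the time. -/
def fixedState (S : Problem n m g N) (i : Fin N) (t : ℕ) : Vec n :=
  closedLoop S.f (S.ctrl i) S.noise S.x0 t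

/-- The cost at time `t` when controller `i` is used all the time. -/
def fixedCost (S : Problem n m g N) (i : Fin N) (t : ℕ) : ℝ :=
  S.cost t (S.fixedState i t) (S.ctrl i (S.fixedState i t))

/-- `i` is a best stabilizing controller for the rounds `0, …, T`. -/
def IsBestStabilizing (S : Problem n m g N) (β : ℕ → ℝ) (γ : ℝ) (T : ℕ) (i : Fin N) : Prop :=
  i ∈ S.stabilizing β γ ∧ ∀ j ∈ S.stabilizing β γ,
    ∑ t ∈ Finset.range (T + 1), S.fixedCost i t ≤ ∑ t ∈ Finset.range (T + 1), S.fixedCost j t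

end Problem

/-! ### The algorithm -/

/-- Polynomial batches: `τ_0 = ⌊z₁ z₂^{z₃}⌋` and `τ_b = ⌈z₁ (ν b + z₂)^{z₃}⌉` for `b ≥ 1`. -/
noncomputable def polyBatch (z₁ z₂ z₃ ν : ℝ) (b : ℕ) : ℕ :=
  if b = 0 then ⌊z₁ * z₂ ^ z₃⌋₊ else ⌈z₁ * (ν * b + z₂) ^ z₃⌉₊

/-- The inputs of the algorithm. The rule `pick` resolves the free choice of `α_{b+1}`; its
arguments are the controllers chosen so far (latest first), `α_b`, `s_b` and `‖x_{t_{b+1}}‖`. -/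
structure Input (N : ℕ) where
  β : ℕ → ℝ
  γ : ℝ
  τ : ℕ → ℕ
  η0 : ℝ
  y : ℝ
  α0 : ℝ
  δ : ℝ
  pick : List (Fin N) → ℝ → ℕ → ℝ → ℝ

/-- The rule `pick` returns an `α > α_b` with
`α^{s_b+1} ‖x_0‖ ≤ ‖x_{t_{b+1}}‖ - δ < α^{s_b+2} ‖x_0‖` in all cases in which it can be called.
Here `ρ` stands for `‖x_0‖`. -/
def Input.ValidPick {N : ℕ} (A : Input N) (ρ : ℝ) : Prop :=
  ∀ (h : List (Fin N)) (a : ℝ) (s : ℕ) (r : ℝ), 1 < a → a ^ (s + 2) * ρ ≤ r - A.δ →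
    a < A.pick h a s r ∧ A.pick h a s r ^ (s + 1) * ρ ≤ r - A.δ ∧
      r - A.δ < A.pick h a s r ^ (s + 2) * ρ

/-- `s` is the level of `v` on the scale `ρ, a ρ, a² ρ, …`. -/
def IsLevel (a ρ v : ℝ) (s : ℕ) : Prop := 1 ≤ s ∧ a ^ s * ρ ≤ v ∧ v < a ^ (s + 1) * ρ

theorem existsUnique_isLevel {a ρ v : ℝ} (ha : 1 < a) (hρ : 0 < ρ) (hv : a * ρ ≤ v) :
    ∃! s, IsLevel a ρ v s := by
  have h1 : 1 ≤ v / ρ := by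
    rw [le_div_iff₀ hρ]; nlinarith
  obtain ⟨s, hs1, hs2⟩ := exists_nat_pow_near h1 ha
  rw [le_div_iff₀ hρ] at hs1
  rw [div_lt_iff₀ hρ] at hs2
  have mono : ∀ {i j : ℕ}, a ^ i * ρ ≤ v → v < a ^ (j + 1) * ρ → i ≤ j := by
    intro i j hi hj
    have : a ^ i < a ^ (j + 1) := lt_of_mul_lt_mul_right (lt_of_le_of_lt hi hj) hρ.le
    exact Nat.lt_succ_iff.mp ((pow_lt_pow_iff_right₀ ha).mp this)
  refine ⟨s, ⟨mono (i := 1) (by simpa using hv) hs2, hs1, hs2⟩, ?_⟩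
  rintro j ⟨_, hj1, hj2⟩
  exact le_antisymm (mono hj1 hs2) (mono hs1 hj2)

/-- The level of `v` (it exists and is unique when `1 < a`, `0 < ρ`, `a ρ ≤ v`). -/
noncomputable def level (a ρ v : ℝ) : ℕ := Classical.epsilon (IsLevel a ρ v)

/-- The variables of the algorithm at the beginning of a batch `b`: the start time `t_b`, the
state `x_{t_b}`, the remaining pool `𝒫_b`, the scale `α_b` and level `s_b`, the number `μ_b` of
falsifications, and the weights `W_b`. -/
structure State (n N : ℕ) where
  t : ℕ
  x : Vec n
  P : Finset (Fin N)
  α : ℝ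
  s : ℕ
  μ : ℕ
  W : Fin N → ℝ

section Algorithm

variable {n m g N : ℕ}

/-- Learning rate `η_b = η_0 (μ_b + 1)^y / α_b^{2 s_b}`. -/
noncomputable def rate (A : Input N) (st : State n N) : ℝ :=
  A.η0 * ((st.μ : ℝ) + 1) ^ A.y / st.α ^ (2 * st.s)

/-- Sampling distribution `p_b`: exponential weights on the remaining pool. -/
noncomputable def prob (A : Input N) (st : State n N) (k : Fin N) : ℝ :=
  if k ∈ st.P then
    Real.exp (-rate A st * st.W k) / ∑ i ∈ st.P, Real.exp (-rate A st * st.W i)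
  else 0

/-- State `j` steps after the beginning of the batch, if controller `k` is used in the batch. -/
def batchState (S : Problem n m g N) (st : State n N) (k : Fin N) (j : ℕ) : Vec n :=
  closedLoop S.f (S.ctrl k) (fun i => S.noise (st.t + i)) st.x j

/-- The stability test after `j` steps of batch `b` fails. -/
def Violated (S : Problem n m g N) (A : Input N) (b : ℕ) (st : State n N) (k : Fin N)
    (j : ℕ) : Prop :=
  1 ≤ j ∧ j ≤ A.τ b ∧ A.β j * ‖st.x‖ + A.γ * S.wmax < ‖batchState S st k j‖

/-- The Break statement is activated in batch `b`. -/
def Breaks (S : Problem n m g N) (A : Input N) (b : ℕ) (st : State n N) (k : Fin N) : Prop :=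
  ∃ j, Violated S A b st k j

open Classical in
/-- Number of rounds in batch `b`: up to the first failed test, and `τ_b` if there is none. -/
noncomputable def batchLen (S : Problem n m g N) (A : Input N) (b : ℕ) (st : State n N)
    (k : Fin N) : ℕ :=
  if h : Breaks S A b st k then Nat.find h else A.τ b

/-- Cost `w_b(k)` of batch `b`. -/
noncomputable def batchCost (S : Problem n m g N) (A : Input N) (b : ℕ) (st : State n N)
    (k : Fin N) : ℝ :=
  ∑ j ∈ Finset.range (batchLen S A b st k),
    S.cost (st.t + j) (batchState S st k j) (S.ctrl k (batchState S st k j))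

/-- The state `x_{t_{b+1}}` with which batch `b` ends. -/
noncomputable def endState (S : Problem n m g N) (A : Input N) (b : ℕ) (st : State n N)
    (k : Fin N) : Vec n :=
  batchState S st k (batchLen S A b st k)

open Classical in
/-- The remaining pool `𝒫_{b+1}`. -/
noncomputable def nextPool (S : Problem n m g N) (A : Input N) (b : ℕ) (st : State n N)
    (k : Fin N) : Finset (Fin N) :=
  if Breaks S A b st k then st.P.erase k else st.P

open Classical in
/-- The pair `(α_{b+1}, s_{b+1})`; `h` is the list of the controllers chosen before batch `b`. -/
noncomputable def nextScale (S : Problem n m g N) (A : Input N) (h : List (Fin N))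
    (st : State n N) (k : Fin N) : ℝ × ℕ :=
  let r : ℝ := ‖endState S A h.length st k‖
  if st.α * ‖S.x0‖ + A.δ ≤ r then
    if st.s + 1 < level st.α ‖S.x0‖ (r - A.δ) then (A.pick (k :: h) st.α st.s r, st.s + 1)
    else (st.α, level st.α ‖S.x0‖ (r - A.δ))
  else (st.α, 0)

open Classical in
/-- One batch of the algorithm, with controller `k`, after the choices `h`. -/
noncomputable def nextState (S : Problem n m g N) (A : Input N) (h : List (Fin N))
    (st : State n N) (k : Fin N) : State n N where
  t := st.t + batchLen S A h.length st k
  x := endState S A h.length st k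
  P := nextPool S A h.length st k
  α := (nextScale S A h st k).1
  s := (nextScale S A h st k).2
  μ := if nextPool S A h.length st k = st.P then st.μ else st.μ + 1
  W := fun i =>
    if (nextScale S A h st k).2 ≠ st.s then 0
    else st.W i + (if i = k then batchCost S A h.length st k / prob A st i else 0)

/-- The variables of the algorithm after the choices `h = [K_{b-1}, …, K_0]`. -/
noncomputable def run (S : Problem n m g N) (A : Input N) : List (Fin N) → State n N
  | [] => { t := 0, x := S.x0, P := Finset.univ, α := A.α0, s := 0, μ := 0, W := fun _ => 0 }
  | k :: h => nextState S A h (run S A h) k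

/-- The list `[κ_{b-1}, …, κ_0]`. -/
def history (κ : ℕ → Fin N) : ℕ → List (Fin N)
  | 0 => []
  | b + 1 => κ b :: history κ b

/-- The batch that contains round `t`: the last one that starts at or before `t` (every batch has
at least one round, so batch `b` does not start before round `b`). -/
noncomputable def batchAt (S : Problem n m g N) (A : Input N) (κ : ℕ → Fin N) (t : ℕ) : ℕ :=
  open Classical in Nat.findGreatest (fun b => (run S A (history κ b)).t ≤ t) t

/-- State `x_t` of the system under the algorithm, when the sampled controllers are `κ`. -/
noncomputable def algState (S : Problem n m g N) (A : Input N) (κ : ℕ → Fin N) (t : ℕ) : Vec n :=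
  let b := batchAt S A κ t
  batchState S (run S A (history κ b)) (κ b) (t - (run S A (history κ b)).t)

/-- Action `u_t` of the algorithm, when the sampled controllers are `κ`. -/
noncomputable def algAction (S : Problem n m g N) (A : Input N) (κ : ℕ → Fin N) (t : ℕ) : Vec m :=
  S.ctrl (κ (batchAt S A κ t)) (algState S A κ t)

/-- The random controllers `K_0, K_1, …` are sampled as the algorithm prescribes: given the
choices `h` in the previous batches, the next one has the law `p_b`. -/
structure IsSampled (S : Problem n m g N) (A : Input N) {Ω : Type*} [MeasurableSpace Ω]
    (P : Measure Ω) (K : ℕ → Ω → Fin N) : Prop where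
  measurable : ∀ b, Measurable (K b)
  law : ∀ (h : List (Fin N)) (k : Fin N),
    P.real {ω | history (fun b => K b ω) (h.length + 1) = k :: h} =
      P.real {ω | history (fun b => K b ω) h.length = h} * prob A (run S A h) k

/-- Regret over the rounds `0, …, T` against the controller `i`. -/
noncomputable def regret (S : Problem n m g N) (A : Input N) {Ω : Type*} [MeasurableSpace Ω]
    (P : Measure Ω) (K : ℕ → Ω → Fin N) (T : ℕ) (i : Fin N) : ℝ :=
  ∫ ω, ∑ t ∈ Finset.range (T + 1),
    (S.cost t (algState S A (fun b => K b ω) t) (algAction S A (fun b => K b ω) t)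
      - S.fixedCost i t) ∂P

end Algorithm

end DBAR

/-! Write `U` for the number of destabilizing controllers, `D = T^{2/3} N^{1/3}`, and `H` for the
partial sums of `β`. The regret is split by level: batches of level 0 are analysed by exponential
weights in expectation, batches of positive level are few and are bounded pathwise.

Stability. Only a controller that is not ISS can fail the test (`Breaks.mem_destabilizing`), so at
most `U` batches are falsified and the comparator never leaves the pool. A falsified batch
multiplies `1 + ‖x‖` by at most `3 G²`; any other batch contracts `‖x‖` towards `δ` with a factor at
most `3/5`. Hence the states are at most `stateBound G U = e^{O(U)}`, their fourth powers over `B`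
batches sum to `O(B) + e^{O(U)}` (`sum_norm_pow_le`), and the number of batches of positive level is
at most `e^{O(U)}`, independently of `B` (`sum_positive_level_le`).

Learning. At level 0 the potential is the log-partition function plus the weight of the comparator,
as for bandits. The weights are reset when the level changes, but level 0 is left only through a
falsification (`breaks_of_level`). A restart after `i` falsifications costs `log N / (η₀ √(i+1))`,
and these costs sum to `O(√(U+1) log N / η₀)`; the potential carries the unpaid part as
`restartPrice`. Since the rate grows like `√(μ+1)`, the second-order terms also lose only a factor
`√(U+1)`. The one-step inequality `expected_step` telescopes to `Tame.regret_le`.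

Comparator. In a batch the comparator would start from the state of the algorithm instead of its
own; incremental stability bounds the excess cost by a multiple of `H(τ) (1 + ‖x‖⁴)`.

Balance. About `D` batches of length about `(T/N)^{1/3}` cover the horizon. With `η₀` of order
`1/D`, both `log N / η₀` and `η₀ N τ² B` are of order `D` up to a logarithm, and the excess of the
comparator is `D H(τ)`: it is `o(T)` because `H(τ)/τ` is a Cesàro mean of `β`, and `Õ(D)` if `H`
grows logarithmically. What remains is `e^{O(U)} T^{1/3}`, which `mul_le_sq_add_cube_div`
distributes over `T^{2/3}` and `T^{-1/3} e^{O(U)}`. -/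

namespace DBAR

/-! ### Exponential weights -/

section ExponentialWeights

variable {ι : Type*}

/-- The scaled log-partition function of exponential weights. -/
noncomputable def logPartition (η : ℝ) (P : Finset ι) (W : ι → ℝ) : ℝ :=
  Real.log (∑ i ∈ P, Real.exp (-η * W i)) / η

theorem partition_pos {η : ℝ} {P : Finset ι} {W : ι → ℝ} (hP : P.Nonempty) :
    0 < ∑ i ∈ P, Real.exp (-η * W i) :=
  Finset.sum_pos (fun _ _ => Real.exp_pos _) hP

theorem neg_le_logPartition {η : ℝ} (hη : 0 < η) {P : Finset ι} (W : ι → ℝ) {i : ι}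
    (hi : i ∈ P) : -W i ≤ logPartition η P W := by
  rw [logPartition, le_div_iff₀ hη, Real.le_log_iff_exp_le (partition_pos ⟨i, hi⟩)]
  rw [show -W i * η = -η * W i by ring]
  exact Finset.single_le_sum (f := fun i => Real.exp (-η * W i))
    (fun _ _ => (Real.exp_pos _).le) hi

theorem logPartition_mono_pool {η : ℝ} (hη : 0 < η) {P P' : Finset ι} (h : P' ⊆ P)
    (hP : P'.Nonempty) (W : ι → ℝ) : logPartition η P' W ≤ logPartition η P W := by
  unfold logPartition
  have := partition_pos (η := η) (W := W) hP
  gcongr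

/-- The exponential of `logPartition η P W` is the `ℓ^η` (quasi-)norm of the vector `exp (-W i)`,
and such norms decrease in the exponent. So raising the learning rate after a falsification costs
nothing. -/
theorem logPartition_anti_rate {η η' : ℝ} (hη : 0 < η) (h : η ≤ η') {P : Finset ι}
    (hP : P.Nonempty) (W : ι → ℝ) : logPartition η' P W ≤ logPartition η P W := by
  have hη' := hη.trans_le h
  set Z := ∑ i ∈ P, Real.exp (-η * W i) with hZ
  have hZ0 : 0 < Z := partition_pos hP
  have key : ∑ i ∈ P, Real.exp (-η' * W i) ≤ Z ^ (η' / η) := by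
    -- Each share of `Z` is at most 1, so the power `η' / η ≥ 1` can only lower it; the shares sum
    -- to 1.
    have h1 : ∀ i ∈ P, Real.exp (-η' * W i) ≤ Real.exp (-η * W i) / Z * Z ^ (η' / η) := by
      intro i hi
      have hle : Real.exp (-η * W i) / Z ≤ 1 := by
        rw [div_le_one hZ0]
        exact Finset.single_le_sum (f := fun i => Real.exp (-η * W i))
          (fun _ _ => (Real.exp_pos _).le) hi
      have hpos : 0 < Real.exp (-η * W i) / Z := by positivity
      have h2 := Real.rpow_le_rpow_of_exponent_ge hpos hle ((one_le_div hη).2 h)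
      rw [Real.rpow_one, Real.div_rpow (Real.exp_pos _).le hZ0.le, ← Real.exp_mul,
        div_le_iff₀ (by positivity)] at h2
      rwa [show -η * W i * (η' / η) = -η' * W i by field_simp] at h2
    calc _ ≤ ∑ i ∈ P, Real.exp (-η * W i) / Z * Z ^ (η' / η) := Finset.sum_le_sum h1
      _ = _ := by rw [← Finset.sum_mul, ← Finset.sum_div, ← hZ, div_self hZ0.ne', one_mul]
  rw [logPartition, logPartition, ← hZ, div_le_iff₀ hη']
  calc _ ≤ Real.log (Z ^ (η' / η)) := Real.log_le_log (partition_pos hP) key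
    _ = _ := by rw [Real.log_rpow hZ0]; field_simp

theorem logPartition_zero_le {η : ℝ} (hη : 0 < η) {P : Finset ι} (hP : P.Nonempty) {N : ℕ}
    (hN : P.card ≤ N) : logPartition η P (fun _ => 0) ≤ Real.log N / η := by
  have : 0 < P.card := hP.card_pos
  simp only [logPartition, mul_zero, Real.exp_zero, Finset.sum_const, nsmul_eq_mul, mul_one]
  gcongr

theorem exp_neg_le_quadratic {x : ℝ} (hx : 0 ≤ x) : Real.exp (-x) ≤ 1 - x + x ^ 2 / 2 := by
  have h1 : 1 + x + x ^ 2 / 2 ≤ Real.exp x := Real.quadratic_le_exp_of_nonneg hx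
  rw [Real.exp_neg, inv_le_comm₀ (Real.exp_pos _) (by nlinarith [sq_nonneg (x - 1)])]
  refine le_trans ?_ h1
  rw [inv_le_iff_one_le_mul₀ (by nlinarith [sq_nonneg (x - 1)])]
  nlinarith [sq_nonneg (x ^ 2)]

/-- Charging `c / p` to `k` multiplies the partition sum by `1 + p (exp (-η c / p) - 1)`. The
quadratic bound on `exp (-x)`, available because costs are nonnegative, and `log x ≤ x - 1` leave
the gain `c` and an error whose `1 / p` cancels in expectation. -/
theorem logPartition_update [DecidableEq ι] {η : ℝ} (hη : 0 < η) {P : Finset ι} (W : ι → ℝ)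
    {k : ι} (hk : k ∈ P) {c p : ℝ} (hc : 0 ≤ c)
    (hp : p = Real.exp (-η * W k) / ∑ i ∈ P, Real.exp (-η * W i)) :
    logPartition η P (fun i => W i + if i = k then c / p else 0) ≤
      logPartition η P W - c + η / 2 * c ^ 2 / p := by
  have hP : P.Nonempty := ⟨k, hk⟩
  set Z := ∑ i ∈ P, Real.exp (-η * W i) with hZ
  have hZ0 : 0 < Z := partition_pos hP
  have hp0 : 0 < p := by rw [hp]; positivity
  have hsum : ∑ i ∈ P, Real.exp (-η * (W i + if i = k then c / p else 0)) =
      Z * (1 + p * (Real.exp (-(η * (c / p))) - 1)) := by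
    have : ∀ i ∈ P, Real.exp (-η * (W i + if i = k then c / p else 0)) =
        Real.exp (-η * W i) +
          if i = k then Real.exp (-η * W k) * (Real.exp (-(η * (c / p))) - 1) else 0 := by
      intro i _
      split_ifs with h
      · subst h
        rw [mul_add, Real.exp_add, neg_mul η (c / p)]; ring
      · simp
    rw [Finset.sum_congr rfl this, Finset.sum_add_distrib, Finset.sum_ite_eq' P k, if_pos hk, ← hZ]
    have : Real.exp (-η * W k) = p * Z := by rw [hp]; field_simp
    rw [this]; ring
  have hfac : 0 < 1 + p * (Real.exp (-(η * (c / p))) - 1) := by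
    have := partition_pos (η := η) (W := fun i => W i + if i = k then c / p else 0) hP
    rw [hsum] at this
    exact (pos_iff_pos_of_mul_pos this).1 hZ0
  have hx : 0 ≤ η * (c / p) := by positivity
  have hquad := exp_neg_le_quadratic hx
  have hlog : Real.log (1 + p * (Real.exp (-(η * (c / p))) - 1)) ≤
      η * (-c + η / 2 * c ^ 2 / p) := by
    refine (Real.log_le_sub_one_of_pos hfac).trans ?_
    have : p * (Real.exp (-(η * (c / p))) - 1) ≤
        p * (-(η * (c / p)) + (η * (c / p)) ^ 2 / 2) := by
      gcongr; linarith
    calc _ ≤ p * (-(η * (c / p)) + (η * (c / p)) ^ 2 / 2) := by linarith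
      _ = _ := by field_simp
  rw [logPartition, logPartition, hsum, Real.log_mul hZ0.ne' hfac.ne', ← hZ, add_div]
  have : Real.log (1 + p * (Real.exp (-(η * (c / p))) - 1)) / η ≤ -c + η / 2 * c ^ 2 / p := by
    rw [div_le_iff₀ hη]
    linarith
  linarith

end ExponentialWeights

/-! ### Elementary estimates -/

/-- Summation of a contracting recursion with finitely many perturbations. -/
theorem sum_le_of_contraction {a : ℕ → ℝ} {μ : ℕ → ℕ} {q c d : ℝ} (hq : q ≤ 3 / 5)
    (ha : ∀ b, 0 ≤ a b) {B : ℕ}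
    (hstep : ∀ b < B, a (b + 1) ≤ q * a b + c + d * ((μ (b + 1) : ℝ) - μ b)) :
    2 / 5 * ∑ b ∈ Finset.range B, a b ≤ a 0 + B * c + d * ((μ B : ℝ) - μ 0) := by
  suffices h : ∀ b ≤ B, 2 / 5 * ∑ i ∈ Finset.range b, a i + a b ≤
      a 0 + b * c + d * ((μ b : ℝ) - μ 0) by
    linarith [h B le_rfl, ha B]
  intro b
  induction b with
  | zero => simp
  | succ b ih =>
    intro hb
    have h1 := ih (by omega)
    have h2 := hstep b (by omega)
    have h3 := mul_le_mul_of_nonneg_right hq (ha b)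
    rw [Finset.sum_range_succ]
    push_cast
    linarith

/-- Telescoping of `1 / v ≤ 2 (v - u)` for consecutive square roots `u`, `v`. The `i`-th term is the
relative price of a restart after `i` falsifications. -/
theorem sum_rsqrt_le (U : ℕ) :
    ∑ i ∈ Finset.range (U + 1), 1 / ((i : ℝ) + 1) ^ (1 / 2 : ℝ) ≤
      2 * ((U : ℝ) + 1) ^ (1 / 2 : ℝ) := by
  simp only [← Real.sqrt_eq_rpow]
  induction U with
  | zero => simp
  | succ U ih =>
    rw [Finset.sum_range_succ]
    push_cast
    refine (add_le_add_left ih _).trans ?_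
    set u : ℝ := √((U : ℝ) + 1)
    set v : ℝ := √((U : ℝ) + 1 + 1)
    have hu : 0 < u := Real.sqrt_pos.2 (by positivity)
    have hv : 0 < v := Real.sqrt_pos.2 (by positivity)
    have hu2 : u ^ 2 = (U : ℝ) + 1 := Real.sq_sqrt (by positivity)
    have hv2 : v ^ 2 = (U : ℝ) + 1 + 1 := Real.sq_sqrt (by positivity)
    have : 1 / v ≤ 2 * (v - u) := by
      rw [div_le_iff₀ hv]
      nlinarith [sq_nonneg (v - u)]
    linarith

/-- Used with `x = e^{O(U)}` and `a = T^{1/3}`, to separate the dependence on `U` from the leading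
power of `T`. -/
theorem mul_le_sq_add_cube_div {x a : ℝ} (hx : 0 ≤ x) (ha : 0 < a) :
    x * a ≤ a ^ 2 + x ^ 3 / a := by
  rcases le_total x a with h | h
  · have : 0 ≤ x ^ 3 / a := by positivity
    nlinarith
  · have : x * a ≤ x ^ 3 / a := by
      rw [le_div_iff₀ ha]
      nlinarith [mul_le_mul h h ha.le hx]
    nlinarith [sq_nonneg a]

/-! ### Deterministic analysis of one batch -/

/-- A control problem and an input of the algorithm whose quantitative assumptions are all
expressed through one constant `G` and one contraction factor `q`. -/
structure Tame {n m g N : ℕ} (S : Problem n m g N) (A : Input N) (istar : Fin N) (G q : ℝ) :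
    Prop where
  one_le : 1 ≤ G
  decay : IsDecayRate A.β
  noise : S.BoundedNoise
  cost_nonneg : ∀ t x u, 0 ≤ S.cost t x u
  cost_le : ∀ t k x, S.cost t x (S.ctrl k x) ≤ G * (1 + ‖x‖ ^ 2)
  cost_sub_le : ∀ t k x y, S.cost t x (S.ctrl k x) - S.cost t y (S.ctrl k y) ≤
    G * (1 + ‖x‖ + ‖y‖) * ‖x - y‖
  growth : ∀ k x w, ‖w‖ ≤ S.wmax → ‖S.f x (S.ctrl k x) w‖ ≤ G * (1 + ‖x‖)
  gain_nonneg : 0 ≤ A.γ * S.wmax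
  gain_le : A.γ * S.wmax ≤ G
  gain_le_offset : A.γ * S.wmax ≤ (1 - q) * A.δ
  offset_le : A.δ ≤ G
  start_le : ‖S.x0‖ ≤ G
  le_start : 1 ≤ G * ‖S.x0‖
  factor_nonneg : 0 ≤ q
  factor_le : q ≤ 3 / 5
  decay_le : ∀ b, A.β (A.τ b) ≤ q
  scale : 1 < A.α0
  pick : A.ValidPick ‖S.x0‖
  batch_pos : ∀ b, 0 < A.τ b
  batch_mono : Monotone A.τ
  star : istar ∈ S.stabilizing A.β A.γ
  rate_pos : 0 < A.η0
  exponent : A.y = 1 / 2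

section OneBatch

variable {n m g N : ℕ} {S : Problem n m g N} {A : Input N} {istar : Fin N} {G q : ℝ}

theorem IsDecayRate.nonneg {β : ℕ → ℝ} (h : IsDecayRate β) (t : ℕ) : 0 ≤ β t :=
  h.1.le_of_tendsto h.2.2 t

theorem IsDecayRate.le_one {β : ℕ → ℝ} (h : IsDecayRate β) (t : ℕ) : β t ≤ 1 :=
  h.2.1 ▸ h.1 (Nat.zero_le t)

theorem decaySum_nonneg {β : ℕ → ℝ} (h : IsDecayRate β) (t : ℕ) : 0 ≤ decaySum β t :=
  Finset.sum_nonneg fun i _ => h.nonneg i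

theorem decaySum_mono {β : ℕ → ℝ} (h : IsDecayRate β) : Monotone (decaySum β) := fun _ _ hst =>
  Finset.sum_le_sum_of_subset_of_nonneg (Finset.range_mono hst) fun i _ _ => h.nonneg i

namespace Tame

theorem start_pos (hT : Tame S A istar G q) : 0 < ‖S.x0‖ := by
  have := hT.le_start
  have := hT.one_le
  by_contra! h
  nlinarith

theorem offset_nonneg (hT : Tame S A istar G q) : 0 ≤ A.δ := by
  have := hT.gain_nonneg.trans hT.gain_le_offset
  have := hT.factor_le
  by_contra! h
  nlinarith

end Tame

/-- The test is the ISS inequality along the batch trajectory with shifted disturbances, so a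
failure refutes ISS. -/
theorem Breaks.mem_destabilizing (hw : S.BoundedNoise) {b : ℕ} {st : State n N} {k : Fin N}
    (h : Breaks S A b st k) : k ∈ S.destabilizing A.β A.γ := by
  obtain ⟨j, _, _, hj⟩ := h
  intro hk
  exact absurd (hk st.x (fun i => S.noise (st.t + i)) (fun i => hw _) j) (not_le.2 hj)

theorem batchLen_of_not_breaks {b : ℕ} {st : State n N} {k : Fin N} (h : ¬ Breaks S A b st k) :
    batchLen S A b st k = A.τ b := by
  rw [batchLen, dif_neg h]

theorem Breaks.violated {b : ℕ} {st : State n N} {k : Fin N} (h : Breaks S A b st k) :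
    Violated S A b st k (batchLen S A b st k) := by
  classical
  rw [batchLen, dif_pos h]
  exact Nat.find_spec h

theorem batchLen_le (b : ℕ) (st : State n N) (k : Fin N) : batchLen S A b st k ≤ A.τ b := by
  by_cases h : Breaks S A b st k
  · exact h.violated.2.1
  · exact (batchLen_of_not_breaks h).le

theorem batchLen_pos (hτ : ∀ b, 0 < A.τ b) (b : ℕ) (st : State n N) (k : Fin N) :
    0 < batchLen S A b st k := by
  by_cases h : Breaks S A b st k
  · exact h.violated.1
  · exact batchLen_of_not_breaks h ▸ hτ b

theorem not_violated_of_lt {b : ℕ} {st : State n N} {k : Fin N} {j : ℕ}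
    (hj : j < batchLen S A b st k) : ¬ Violated S A b st k j := by
  classical
  by_cases h : Breaks S A b st k
  · rw [batchLen, dif_pos h] at hj
    exact Nat.find_min h hj
  · exact fun hv => h ⟨j, hv⟩

namespace Tame

/-- Valid in falsified batches too: the batch ends at the first failed test, so every earlier state
has passed. -/
theorem norm_batchState_le (hT : Tame S A istar G q) {b : ℕ} {st : State n N} {k : Fin N} {j : ℕ}
    (hj : j < batchLen S A b st k) :
    ‖batchState S st k j‖ ≤ A.β j * ‖st.x‖ + A.γ * S.wmax := by
  rcases Nat.eq_zero_or_pos j with rfl | h0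
  · rw [hT.decay.2.1]
    have := hT.gain_nonneg
    simp only [batchState, closedLoop]
    linarith
  · by_contra! h
    exact not_violated_of_lt hj ⟨h0, hj.le.trans (batchLen_le b st k), h⟩

theorem norm_batchState_le' (hT : Tame S A istar G q) {b : ℕ} {st : State n N} {k : Fin N} {j : ℕ}
    (hj : j < batchLen S A b st k) : ‖batchState S st k j‖ ≤ ‖st.x‖ + G := by
  have h1 := hT.norm_batchState_le hj
  have h2 := mul_le_mul_of_nonneg_right (hT.decay.le_one j) (norm_nonneg st.x)
  have := hT.gain_le
  linarith

/-- The last state may have failed the test, but it is one step of the dynamics away from a state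
that passed. The factor `3 G²` is the price of a falsification. -/
theorem norm_endState_le (hT : Tame S A istar G q) {b : ℕ} {st : State n N} {k : Fin N} :
    1 + ‖endState S A b st k‖ ≤ 3 * G ^ 2 * (1 + ‖st.x‖) := by
  obtain ⟨j, hj⟩ : ∃ j, batchLen S A b st k = j + 1 :=
    Nat.exists_eq_succ_of_ne_zero (batchLen_pos hT.batch_pos b st k).ne'
  have h1 := hT.norm_batchState_le' (b := b) (st := st) (k := k) (j := j) (by omega)
  have h2 := hT.growth k (batchState S st k j) (S.noise (st.t + j)) (hT.noise _)
  have h3 : endState S A b st k =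
      S.f (batchState S st k j) (S.ctrl k (batchState S st k j)) (S.noise (st.t + j)) := by
    rw [endState, hj]; rfl
  rw [h3]
  have hG := hT.one_le
  have hx := norm_nonneg st.x
  have h4 := mul_le_mul_of_nonneg_left h1 (zero_le_one.trans hG)
  have h5 : G ≤ G ^ 2 := by nlinarith
  nlinarith

/-- The last test was passed, with `β (τ_b) ≤ q` and `γ wmax ≤ (1 - q) δ`. The bound is a convex
combination of `‖x‖` and `δ`, so both powers of the norm and the excess over `δ` contract. -/
theorem norm_endState_of_not_breaks (hT : Tame S A istar G q) {b : ℕ} {st : State n N} {k : Fin N}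
    (h : ¬ Breaks S A b st k) : ‖endState S A b st k‖ ≤ q * ‖st.x‖ + (1 - q) * A.δ := by
  have h1 : ¬ Violated S A b st k (A.τ b) := fun hv => h ⟨_, hv⟩
  rw [Violated, not_and, not_and, not_lt] at h1
  have h2 := h1 (hT.batch_pos b) le_rfl
  rw [endState, batchLen_of_not_breaks h]
  have h3 := mul_le_mul_of_nonneg_right (hT.decay_le b) (norm_nonneg st.x)
  have := hT.gain_le_offset
  linarith

theorem batchCost_nonneg (hT : Tame S A istar G q) (b : ℕ) (st : State n N) (k : Fin N) :
    0 ≤ batchCost S A b st k :=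
  Finset.sum_nonneg fun _ _ => hT.cost_nonneg _ _ _

theorem batchCost_le (hT : Tame S A istar G q) (b : ℕ) (st : State n N) (k : Fin N) :
    batchCost S A b st k ≤ 3 * G ^ 3 * A.τ b * (1 + ‖st.x‖ ^ 2) := by
  have hG := hT.one_le
  have hx := norm_nonneg st.x
  have h1 : ∀ j ∈ Finset.range (batchLen S A b st k),
      S.cost (st.t + j) (batchState S st k j) (S.ctrl k (batchState S st k j)) ≤
        3 * G ^ 3 * (1 + ‖st.x‖ ^ 2) := by
    intro j hj
    have h2 := hT.norm_batchState_le' (Finset.mem_range.1 hj)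
    have h3 := hT.cost_le (st.t + j) k (batchState S st k j)
    have h4 : ‖batchState S st k j‖ ^ 2 ≤ (‖st.x‖ + G) ^ 2 := by gcongr
    have h5 : 1 + (‖st.x‖ + G) ^ 2 ≤ 3 * G ^ 2 * (1 + ‖st.x‖ ^ 2) := by
      nlinarith [sq_nonneg (‖st.x‖ - G), mul_nonneg (sub_nonneg.2 hG) (sq_nonneg ‖st.x‖),
        mul_nonneg (sub_nonneg.2 (one_le_pow₀ hG (n := 2))) (sq_nonneg ‖st.x‖),
        one_le_pow₀ hG (n := 2)]
    calc _ ≤ G * (1 + ‖batchState S st k j‖ ^ 2) := h3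
      _ ≤ G * (3 * G ^ 2 * (1 + ‖st.x‖ ^ 2)) := by gcongr; linarith
      _ = _ := by ring
  calc batchCost S A b st k ≤ ∑ j ∈ Finset.range (batchLen S A b st k),
        3 * G ^ 3 * (1 + ‖st.x‖ ^ 2) := Finset.sum_le_sum h1
    _ = (batchLen S A b st k : ℝ) * (3 * G ^ 3 * (1 + ‖st.x‖ ^ 2)) := by simp
    _ ≤ (A.τ b : ℝ) * (3 * G ^ 3 * (1 + ‖st.x‖ ^ 2)) := by
        gcongr; exact batchLen_le b st k
    _ = _ := by ring

end Tame

theorem isLevel_level {a ρ v : ℝ} (ha : 1 < a) (hρ : 0 < ρ) (hv : a * ρ ≤ v) :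
    IsLevel a ρ v (level a ρ v) :=
  Classical.epsilon_spec (existsUnique_isLevel ha hρ hv).exists

/-- This is all that the analysis uses about the level rule: whether the level is zero matters, the
values of positive levels do not. -/
theorem nextScale_spec (hρ : 0 < ‖S.x0‖) (hpick : A.ValidPick ‖S.x0‖) (h : List (Fin N))
    (st : State n N) (k : Fin N) (hα : 1 < st.α) :
    1 < (nextScale S A h st k).1 ∧
    ((nextScale S A h st k).2 = 0 →
      ‖endState S A h.length st k‖ < (nextScale S A h st k).1 * ‖S.x0‖ + A.δ) ∧
    ((nextScale S A h st k).2 ≠ 0 →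
      st.α * ‖S.x0‖ + A.δ ≤ ‖endState S A h.length st k‖) := by
  simp only [nextScale]
  split_ifs with h1 h2
  · have hl := isLevel_level hα hρ (le_sub_iff_add_le.2 h1)
    -- In the capped case the true level is at least `s + 2`, which is the precondition of
    -- `ValidPick`.
    have h3 : st.α ^ (st.s + 2) * ‖S.x0‖ ≤ ‖endState S A h.length st k‖ - A.δ := by
      refine le_trans ?_ hl.2.1
      gcongr
      · exact hα.le
      · exact h2
    exact ⟨hα.trans (hpick _ _ _ _ hα h3).1, by simp, fun _ => h1⟩
  · have hl := isLevel_level hα hρ (le_sub_iff_add_le.2 h1)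
    exact ⟨hα, fun h0 => absurd hl.1 (by simp only at h0; omega), fun _ => h1⟩
  · exact ⟨hα, fun _ => not_le.1 h1, by simp⟩

open Classical in
theorem nextState_μ {h : List (Fin N)} {st : State n N} {k : Fin N} (hk : k ∈ st.P) :
    (nextState S A h st k).μ = st.μ + if Breaks S A h.length st k then 1 else 0 := by
  simp only [nextState, nextPool]
  by_cases hb : Breaks S A h.length st k
  · simp [hb, hk]
  · simp [hb]

/-- Every controller in the history was in the pool when it was chosen. -/
def Valid (S : Problem n m g N) (A : Input N) : List (Fin N) → Prop
  | [] => True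
  | k :: h => k ∈ (run S A h).P ∧ Valid S A h

/-- The facts about the variables of the algorithm that persist along valid histories. -/
structure Invariant (S : Problem n m g N) (A : Input N) (G : ℝ) (b : ℕ) (st : State n N) :
    Prop where
  scale : 1 < st.α
  low : st.s = 0 → ‖st.x‖ < st.α * ‖S.x0‖ + A.δ
  high : st.s ≠ 0 → ‖S.x0‖ ≤ ‖st.x‖ - A.δ
  pool : ∀ i ∉ S.destabilizing A.β A.γ, i ∈ st.P
  card : st.μ + st.P.card = N
  bound : 1 + ‖st.x‖ ≤ 2 * G * (3 * G ^ 2) ^ st.μ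
  count : st.μ ≤ b
  time : ∑ i ∈ Finset.range (b - st.μ), A.τ i ≤ st.t

theorem Invariant.μ_le {b : ℕ} {st : State n N} (hI : Invariant S A G b st) :
    st.μ ≤ (S.destabilizing A.β A.γ).ncard := by
  classical
  have h1 : ((st.Pᶜ : Finset (Fin N)) : Set (Fin N)) ⊆ S.destabilizing A.β A.γ := by
    intro i hi
    by_contra h
    simp only [Finset.coe_compl, Set.mem_compl_iff, SetLike.mem_coe] at hi
    exact hi (hI.pool i h)
  have h2 := Set.ncard_le_ncard h1 (Set.toFinite _)
  rw [Set.ncard_coe_finset, Finset.card_compl, Fintype.card_fin] at h2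
  have := hI.card
  omega

theorem Tame.invariant_step (hT : Tame S A istar G q) {h : List (Fin N)} {st : State n N}
    {k : Fin N} (hI : Invariant S A G h.length st) (hk : k ∈ st.P) :
    Invariant S A G (h.length + 1) (nextState S A h st k) := by
  obtain ⟨hs1, hs2, hs3⟩ := nextScale_spec hT.start_pos hT.pick h st k hI.scale
  have hG := hT.one_le
  have hμ := nextState_μ (S := S) (A := A) (h := h) hk
  refine ⟨hs1, hs2, fun h0 => ?_, fun i hi => ?_, ?_, ?_, ?_, ?_⟩
  · have h1 := hs3 h0
    have h2 := mul_le_mul_of_nonneg_right hI.scale.le (norm_nonneg S.x0)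
    change _ ≤ ‖endState S A h.length st k‖ - _
    linarith
  · simp only [nextState, nextPool]
    split_ifs with hb
    · refine Finset.mem_erase.2 ⟨?_, hI.pool i hi⟩
      rintro rfl
      exact hi (hb.mem_destabilizing hT.noise)
    · exact hI.pool i hi
  · have hc := hI.card
    rw [hμ]
    simp only [nextState, nextPool]
    split_ifs with hb
    · rw [Finset.card_erase_of_mem hk]
      have := Finset.card_pos.2 ⟨k, hk⟩
      omega
    · omega
  · rw [hμ]
    have hbd := hI.bound
    change 1 + ‖endState S A h.length st k‖ ≤ _
    split_ifs with hb
    · have h1 := hT.norm_endState_le (b := h.length) (st := st) (k := k)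
      calc _ ≤ 3 * G ^ 2 * (1 + ‖st.x‖) := h1
        _ ≤ 3 * G ^ 2 * (2 * G * (3 * G ^ 2) ^ st.μ) := by gcongr
        _ = _ := by ring
    · have h1 := hT.norm_endState_of_not_breaks hb
      -- Without a falsification, `1 + ‖x‖` is replaced by at most its convex combination with `1 +
      -- δ`, and both are below the bound.
      have h2 : 1 + A.δ ≤ 2 * G * (3 * G ^ 2) ^ st.μ := by
        have h3 : (1 : ℝ) ≤ (3 * G ^ 2) ^ st.μ := one_le_pow₀ (by nlinarith)
        have := hT.offset_le
        nlinarith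
      have hq := hT.factor_nonneg
      have hq1 : 0 ≤ 1 - q := by linarith [hT.factor_le]
      rw [add_zero]
      nlinarith [mul_le_mul_of_nonneg_left hbd hq, mul_le_mul_of_nonneg_left h2 hq1]
  · rw [hμ]
    have := hI.count
    split_ifs <;> omega
  · rw [hμ]
    have hc := hI.count
    have ht := hI.time
    change _ ≤ st.t + batchLen S A h.length st k
    -- A falsified batch raises the batch index and `μ` together and leaves the left side unchanged;
    -- a full batch contributes `τ_b ≥ τ_{b - μ}`.
    split_ifs with hb
    · rw [Nat.add_sub_add_right]
      omega
    · rw [add_zero, Nat.succ_sub hc, Finset.sum_range_succ, batchLen_of_not_breaks hb]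
      have := hT.batch_mono (Nat.sub_le h.length st.μ)
      omega

theorem Tame.invariant (hT : Tame S A istar G q) {h : List (Fin N)} (hv : Valid S A h) :
    Invariant S A G h.length (run S A h) := by
  induction h with
  | nil =>
    have hG := hT.one_le
    refine ⟨hT.scale, fun _ => ?_, fun h0 => absurd rfl h0, fun i _ => Finset.mem_univ i,
      by simp [run], ?_, le_rfl, by simp⟩
    · have := hT.offset_nonneg
      have := hT.scale
      have := hT.start_pos
      simp only [run]
      nlinarith
    · have := hT.start_le
      simp only [run, pow_zero]
      linarith
  | cons k h ih => exact hT.invariant_step (ih hv.2) hv.1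

theorem Tame.star_mem (hT : Tame S A istar G q) {b : ℕ} {st : State n N}
    (hI : Invariant S A G b st) : istar ∈ st.P :=
  hI.pool istar fun h => h hT.star.1

theorem Tame.not_breaks_star (hT : Tame S A istar G q) (b : ℕ) (st : State n N) :
    ¬ Breaks S A b st istar := fun h => h.mem_destabilizing hT.noise hT.star.1

/-- Without a falsification, the level does not leave `0`. -/
theorem Tame.breaks_of_level (hT : Tame S A istar G q) {h : List (Fin N)} {st : State n N}
    {k : Fin N} (hI : Invariant S A G h.length st) (h0 : st.s = 0)
    (hs : (nextState S A h st k).s ≠ 0) : Breaks S A h.length st k := by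
  by_contra hb
  have h1 := (nextScale_spec hT.start_pos hT.pick h st k hI.scale).2.2 hs
  have h2 := hT.norm_endState_of_not_breaks hb
  have h3 := hI.low h0
  have hq := hT.factor_nonneg
  have hq1 := hT.factor_le
  have h4 : 0 < st.α * ‖S.x0‖ := mul_pos (by linarith [hI.scale]) hT.start_pos
  nlinarith [mul_le_mul_of_nonneg_left h3.le hq]

end OneBatch

/-! ### The expected one-step inequality -/

section Potential

variable {n m g N : ℕ} {S : Problem n m g N} {A : Input N} {istar : Fin N} {G q : ℝ}

theorem prob_of_mem {st : State n N} {k : Fin N} (hk : k ∈ st.P) :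
    prob A st k =
      Real.exp (-rate A st * st.W k) / ∑ i ∈ st.P, Real.exp (-rate A st * st.W i) :=
  if_pos hk

theorem prob_of_notMem {st : State n N} {k : Fin N} (hk : k ∉ st.P) : prob A st k = 0 :=
  if_neg hk

theorem prob_pos {st : State n N} {k : Fin N} (hk : k ∈ st.P) : 0 < prob A st k := by
  rw [prob_of_mem hk]
  exact div_pos (Real.exp_pos _) (partition_pos ⟨k, hk⟩)

theorem sum_prob {st : State n N} (hP : st.P.Nonempty) : ∑ k ∈ st.P, prob A st k = 1 := by
  rw [Finset.sum_congr rfl fun k hk => prob_of_mem hk, ← Finset.sum_div,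
    div_self (partition_pos hP).ne']

theorem sum_prob_mul {st : State n N} (F : Fin N → ℝ) :
    ∑ k, prob A st k * F k = ∑ k ∈ st.P, prob A st k * F k :=
  (Finset.sum_subset (Finset.subset_univ _) fun k _ hk => by
    rw [prob_of_notMem hk, zero_mul]).symm

theorem rate_of_level_zero {st : State n N} (hs : st.s = 0) :
    rate A st = A.η0 * ((st.μ : ℝ) + 1) ^ A.y := by
  simp [rate, hs]

/-- Upper bound for the price of all future restarts at level `0`, when at most `U` controllers
can be falsified. -/
noncomputable def restartPrice (A : Input N) (U : ℕ) (st : State n N) : ℝ :=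
  Real.log N / A.η0 * ∑ i ∈ Finset.Ico (if st.s = 0 then st.μ + 1 else st.μ) (U + 1),
    1 / ((i : ℝ) + 1) ^ (1 / 2 : ℝ)

/-- Potential for the regret accumulated in the batches of level `0` that start by time `T`. -/
noncomputable def potential (A : Input N) (istar : Fin N) (U T : ℕ) (st : State n N) : ℝ :=
  if st.t ≤ T then
    (if st.s = 0 then logPartition (rate A st) st.P st.W + st.W istar else 0) +
      restartPrice A U st
  else 0

namespace Tame

theorem sum_Ico_mono (hT : Tame S A istar G q) {U a b : ℕ} (hab : a ≤ b) :
    Real.log N / A.η0 * ∑ i ∈ Finset.Ico b (U + 1), 1 / ((i : ℝ) + 1) ^ (1 / 2 : ℝ) ≤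
      Real.log N / A.η0 * ∑ i ∈ Finset.Ico a (U + 1), 1 / ((i : ℝ) + 1) ^ (1 / 2 : ℝ) := by
  have := hT.rate_pos
  have := Real.log_natCast_nonneg N
  refine mul_le_mul_of_nonneg_left ?_ (by positivity)
  exact Finset.sum_le_sum_of_subset_of_nonneg (Finset.Ico_subset_Ico_left hab)
    fun _ _ _ => by positivity

theorem restartPrice_nonneg (hT : Tame S A istar G q) (U : ℕ) (st : State n N) :
    0 ≤ restartPrice A U st := by
  have := hT.rate_pos
  have := Real.log_natCast_nonneg N
  unfold restartPrice
  positivity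

theorem rate_pos' (hT : Tame S A istar G q) {st : State n N} (hs : st.s = 0) :
    0 < rate A st := by
  have := hT.rate_pos
  rw [rate_of_level_zero hs]
  positivity

theorem potential_nonneg (hT : Tame S A istar G q) {b : ℕ} {st : State n N}
    (hI : Invariant S A G b st) (U T : ℕ) : 0 ≤ potential A istar U T st := by
  have h1 := hT.restartPrice_nonneg U st
  unfold potential
  split_ifs with h2 h3
  · have := neg_le_logPartition (hT.rate_pos' h3) st.W (hT.star_mem hI)
    linarith
  · linarith
  · exact le_rfl

/-- From level `0`, the potential after the batch is controlled by the updated exponential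
weights. -/
theorem potential_next_le (hT : Tame S A istar G q) {h : List (Fin N)} {st : State n N}
    {k : Fin N} (hI : Invariant S A G h.length st) (hk : k ∈ st.P) (hs : st.s = 0) (T : ℕ) :
    batchCost S A h.length st k +
        potential A istar (S.destabilizing A.β A.γ).ncard T (nextState S A h st k) ≤
      logPartition (rate A st) st.P st.W + st.W istar
        + restartPrice A (S.destabilizing A.β A.γ).ncard st
        + rate A st / 2 * batchCost S A h.length st k ^ 2 / prob A st k
        + (if istar = k then batchCost S A h.length st k / prob A st k else 0) := by
  set U := (S.destabilizing A.β A.γ).ncard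
  set w := batchCost S A h.length st k
  have hw : 0 ≤ w := hT.batchCost_nonneg _ _ _
  have hη := hT.rate_pos' hs
  have hI' := hT.invariant_step hI hk
  set W' : Fin N → ℝ := fun i => st.W i + if i = k then w / prob A st k else 0 with hW'
  have h1 : logPartition (rate A st) st.P W' ≤ logPartition (rate A st) st.P st.W - w +
      rate A st / 2 * w ^ 2 / prob A st k :=
    logPartition_update hη st.W hk hw (prob_of_mem hk)
  have hstar : W' istar = st.W istar + if istar = k then w / prob A st k else 0 := by
    simp only [hW']
  have h2 : -W' istar ≤ logPartition (rate A st) st.P W' :=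
    neg_le_logPartition hη W' (hT.star_mem hI)
  have hμ := nextState_μ (S := S) (A := A) (h := h) hk
  suffices hmain : potential A istar U T (nextState S A h st k) ≤
      logPartition (rate A st) st.P W' + W' istar + restartPrice A U st by
    linarith
  have hQ := hT.restartPrice_nonneg U st
  unfold potential
  split_ifs with h3 h4
  · have hne : ¬ (nextScale S A h st k).2 ≠ st.s := by
      rw [hs]; exact not_not.2 h4
    have hWeq : (nextState S A h st k).W = W' := by
      ext i
      simp only [nextState, hW', if_neg hne]
      by_cases hi : i = k
      · subst hi; simp [w]
      · simp [hi]
    -- While the level stays 0 the weights survive. A falsification raises the rate and shrinks the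
    -- pool, and both changes lower the log-partition function.
    have hle : rate A st ≤ rate A (nextState S A h st k) := by
      rw [rate_of_level_zero hs, rate_of_level_zero h4, hT.exponent, hμ]
      have := hT.rate_pos
      gcongr
      simp
    have hsub : (nextState S A h st k).P ⊆ st.P := by
      simp only [nextState, nextPool]
      split_ifs
      · exact Finset.erase_subset _ _
      · exact subset_rfl
    have hne' : (nextState S A h st k).P.Nonempty := ⟨istar, hT.star_mem hI'⟩
    have h5 := (logPartition_anti_rate hη hle hne' W').trans
      (logPartition_mono_pool hη hsub hne' W')
    have h6 : restartPrice A U (nextState S A h st k) ≤ restartPrice A U st := by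
      unfold restartPrice
      rw [if_pos h4, if_pos hs]
      exact hT.sum_Ico_mono (by omega)
    rw [hWeq]
    linarith
  -- Leaving level 0 means a falsification. The new `μ` is the old `μ + 1`, so the sum in the
  -- restart price keeps its range.
  · have hb := hT.breaks_of_level hI hs h4
    have h6 : restartPrice A U (nextState S A h st k) = restartPrice A U st := by
      unfold restartPrice
      rw [if_neg h4, if_pos hs, hμ, if_pos hb]
    linarith
  · linarith

/-- From a positive level, the potential does not exceed the price of the future restarts. -/
theorem potential_next_le' (hT : Tame S A istar G q) {h : List (Fin N)} {st : State n N}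
    {k : Fin N} (hI : Invariant S A G h.length st) (hk : k ∈ st.P) (hs : st.s ≠ 0) (T : ℕ) :
    potential A istar (S.destabilizing A.β A.γ).ncard T (nextState S A h st k) ≤
      restartPrice A (S.destabilizing A.β A.γ).ncard st := by
  have hI' := hT.invariant_step hI hk
  have hμ := nextState_μ (S := S) (A := A) (h := h) hk
  have hU := hI'.μ_le
  set U := (S.destabilizing A.β A.γ).ncard
  have hQ := hT.restartPrice_nonneg U st
  unfold potential
  split_ifs with h3 h4
  · have hne : (nextScale S A h st k).2 ≠ st.s := fun h => hs (h.symm.trans h4)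
    have hWeq : (nextState S A h st k).W = fun _ => 0 := by
      ext i
      simp only [nextState, if_pos hne]
    have hη' := hT.rate_pos' h4
    have h5 := logPartition_zero_le hη' ⟨istar, hT.star_mem hI'⟩
      (N := N) ((Finset.card_le_univ _).trans_eq (Fintype.card_fin N))
    rw [hWeq, add_zero]
    refine (add_le_add_left h5 _).trans ?_
    unfold restartPrice
    rw [if_pos h4, if_neg hs, rate_of_level_zero h4, hT.exponent]
    -- The reset costs `log N / (η₀ √(μ' + 1))` with the new count `μ'`: the bottom term of the
    -- price, present since `μ' ≤ U`.
    refine le_trans (le_of_eq ?_) (hT.sum_Ico_mono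
      (show st.μ ≤ (nextState S A h st k).μ by omega))
    rw [Finset.sum_eq_sum_Ico_succ_bot (by omega : (nextState S A h st k).μ < U + 1)]
    field_simp
  · rw [zero_add]
    unfold restartPrice
    rw [if_neg h4, if_neg hs]
    exact hT.sum_Ico_mono (by omega)
  · exact hQ

/-- Averaging over `p_b` cancels the importance weights: the weight of the comparator grows on
average by its own batch cost, and the second-order term becomes a plain sum over the pool. At
positive levels only the restart price is at stake. -/
theorem expected_step (hT : Tame S A istar G q) {h : List (Fin N)} {st : State n N}
    (hI : Invariant S A G h.length st) (T : ℕ) :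
    ∑ k, prob A st k * ((if st.t ≤ T ∧ st.s = 0 then batchCost S A h.length st k else 0) +
        potential A istar (S.destabilizing A.β A.γ).ncard T (nextState S A h st k)) ≤
      potential A istar (S.destabilizing A.β A.γ).ncard T st +
        if st.t ≤ T ∧ st.s = 0 then batchCost S A h.length st istar +
          rate A st / 2 * ∑ k ∈ st.P, batchCost S A h.length st k ^ 2 else 0 := by
  set U := (S.destabilizing A.β A.γ).ncard with hU
  have hmem := hT.star_mem hI
  rw [sum_prob_mul]
  by_cases ht : st.t ≤ T
  · by_cases hs : st.s = 0
    · simp only [ht, hs, and_self, if_true]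
      have h1 : ∀ k ∈ st.P, prob A st k * (batchCost S A h.length st k +
          potential A istar U T (nextState S A h st k)) ≤
          prob A st k * potential A istar U T st +
            rate A st / 2 * batchCost S A h.length st k ^ 2 +
            (if istar = k then batchCost S A h.length st k else 0) := by
        intro k hk
        have hp := prob_pos (A := A) hk
        refine (mul_le_mul_of_nonneg_left (hT.potential_next_le hI hk hs T) hp.le).trans
          (le_of_eq ?_)
        rw [potential, if_pos ht, if_pos hs, ← hU]
        split_ifs
        · field_simp
        · field_simp
          ring
      refine (Finset.sum_le_sum h1).trans (le_of_eq ?_)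
      rw [Finset.sum_add_distrib, Finset.sum_add_distrib, ← Finset.sum_mul,
        sum_prob ⟨istar, hmem⟩, ← Finset.mul_sum, Finset.sum_ite_eq, if_pos hmem]
      ring
    · simp only [hs, and_false, if_false, zero_add, add_zero]
      calc _ ≤ ∑ k ∈ st.P, prob A st k * restartPrice A U st := Finset.sum_le_sum fun k hk =>
            mul_le_mul_of_nonneg_left (hT.potential_next_le' hI hk hs T) (prob_pos hk).le
        _ = potential A istar U T st := by
          rw [← Finset.sum_mul, sum_prob ⟨istar, hmem⟩, potential, if_pos ht, if_neg hs, one_mul,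
            zero_add]
  · have h1 : ∀ k, potential A istar U T (nextState S A h st k) = 0 := fun k => by
      rw [potential, if_neg]
      simp only [nextState]
      omega
    simp only [h1, ht, false_and, if_false, add_zero, mul_zero, Finset.sum_const_zero]
    simp [potential, ht]

end Tame

end Potential

/-! ### Estimates along a path of the algorithm -/

section Path

variable {n m g N : ℕ} {S : Problem n m g N} {A : Input N} {istar : Fin N} {G q : ℝ}

theorem length_history (κ : ℕ → Fin N) (b : ℕ) : (history κ b).length = b := by
  induction b with
  | zero => rfl
  | succ b ih => rw [history, List.length_cons, ih]

/-- The variables of the algorithm at the beginning of batch `b` along the choices `κ`. -/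
noncomputable def path (S : Problem n m g N) (A : Input N) (κ : ℕ → Fin N) (b : ℕ) : State n N :=
  run S A (history κ b)

theorem path_succ (κ : ℕ → Fin N) (b : ℕ) :
    path S A κ (b + 1) = nextState S A (history κ b) (path S A κ b) (κ b) := rfl

theorem path_t_succ (κ : ℕ → Fin N) (b : ℕ) :
    (path S A κ (b + 1)).t = (path S A κ b).t + batchLen S A b (path S A κ b) (κ b) := by
  conv_rhs => rw [← length_history κ b]
  rw [length_history κ b, path_succ, nextState, length_history]

theorem path_x_succ (κ : ℕ → Fin N) (b : ℕ) :
    (path S A κ (b + 1)).x = endState S A b (path S A κ b) (κ b) := by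
  rw [path_succ, nextState, length_history]

theorem path_t_strictMono (hτ : ∀ b, 0 < A.τ b) (κ : ℕ → Fin N) :
    StrictMono fun b => (path S A κ b).t :=
  strictMono_nat_of_lt_succ fun b => by
    have := batchLen_pos (S := S) hτ b (path S A κ b) (κ b)
    rw [path_t_succ]
    omega

theorem batchAt_eq (hτ : ∀ b, 0 < A.τ b) {κ : ℕ → Fin N} {b t : ℕ} (h1 : (path S A κ b).t ≤ t)
    (h2 : t < (path S A κ (b + 1)).t) : batchAt S A κ t = b := by
  have hmono := path_t_strictMono (S := S) hτ κ
  rw [batchAt, Nat.findGreatest_eq_iff]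
  refine ⟨(hmono.le_apply (x := b)).trans h1, fun _ => h1, fun i hi _ => not_le.2 ?_⟩
  exact h2.trans_le (hmono.monotone (Nat.succ_le_of_lt hi))

theorem batchCost_eq_sum (hτ : ∀ b, 0 < A.τ b) (κ : ℕ → Fin N) (b : ℕ) :
    batchCost S A b (path S A κ b) (κ b) =
      ∑ j ∈ Finset.range (batchLen S A b (path S A κ b) (κ b)),
        S.cost ((path S A κ b).t + j) (algState S A κ ((path S A κ b).t + j))
          (algAction S A κ ((path S A κ b).t + j)) := by
  refine Finset.sum_congr rfl fun j hj => ?_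
  have hb : batchAt S A κ ((path S A κ b).t + j) = b := by
    refine batchAt_eq hτ (Nat.le_add_right _ _) ?_
    rw [path_t_succ]
    have := Finset.mem_range.1 hj
    omega
  have hx : algState S A κ ((path S A κ b).t + j) = batchState S (path S A κ b) (κ b) j := by
    simp only [algState, hb]
    congr 1
    exact Nat.add_sub_cancel_left _ _
  rw [algAction, hx, hb]

/-- The cost of the algorithm is at most the total cost of the batches that start by time `T`. -/
theorem Tame.sum_cost_le (hT : Tame S A istar G q) (κ : ℕ → Fin N) {B T : ℕ}
    (hB : T < (path S A κ B).t) :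
    ∑ t ∈ Finset.range (T + 1), S.cost t (algState S A κ t) (algAction S A κ t) ≤
      ∑ b ∈ Finset.range B,
        if (path S A κ b).t ≤ T then batchCost S A b (path S A κ b) (κ b) else 0 := by
  set F : ℕ → ℝ := fun t => S.cost t (algState S A κ t) (algAction S A κ t)
  have hF : ∀ t, 0 ≤ F t := fun t => hT.cost_nonneg _ _ _
  -- Truncating at `T + 1` allows an induction over all `B`; the batch in which `T` falls is counted
  -- in full, since costs are nonnegative.
  suffices h : ∀ B, ∑ t ∈ Finset.range (min (path S A κ B).t (T + 1)), F t ≤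
      ∑ b ∈ Finset.range B,
        if (path S A κ b).t ≤ T then batchCost S A b (path S A κ b) (κ b) else 0 by
    have := h B
    rwa [min_eq_right hB] at this
  intro B
  induction B with
  | zero => simp [path, history, run]
  | succ B ih =>
    rw [Finset.sum_range_succ]
    split_ifs with ht
    · rw [min_eq_left (by omega)] at ih
      calc _ ≤ ∑ t ∈ Finset.range (path S A κ (B + 1)).t, F t :=
            Finset.sum_le_sum_of_subset_of_nonneg (Finset.range_mono (min_le_left _ _))
              fun _ _ _ => hF _
        _ ≤ _ := by
          rw [path_t_succ, Finset.sum_range_add, batchCost_eq_sum hT.batch_pos]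
          linarith
    · rw [add_zero]
      rw [min_eq_right (by omega)] at ih
      refine le_trans ?_ ih
      exact Finset.sum_le_sum_of_subset_of_nonneg (Finset.range_mono (min_le_right _ _))
        fun _ _ _ => hF _

/-- Upper bound for the norm of the states when at most `U` controllers can be falsified. -/
noncomputable def stateBound (G : ℝ) (U : ℕ) : ℝ := 2 * G * (3 * G ^ 2) ^ U

theorem closedLoop_add (f : Vec n → Vec m → Vec g → Vec n) (c : Vec n → Vec m) (w : ℕ → Vec g)
    (x : Vec n) (s t : ℕ) :
    closedLoop f c w x (s + t) =
      closedLoop f c (fun i => w (s + i)) (closedLoop f c w x s) t := by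
  induction t with
  | zero => rfl
  | succ t ih => rw [← add_assoc, closedLoop, closedLoop, ih]

namespace Tame

theorem norm_fixedState_le (hT : Tame S A istar G q) (t : ℕ) :
    ‖S.fixedState istar t‖ ≤ 2 * G := by
  have h1 := hT.star.1 S.x0 S.noise hT.noise t
  have h2 := mul_le_mul_of_nonneg_right (hT.decay.le_one t) (norm_nonneg S.x0)
  have := hT.gain_le
  have := hT.start_le
  change ‖closedLoop S.f (S.ctrl istar) S.noise S.x0 t‖ ≤ _
  linarith

theorem fixedCost_nonneg (hT : Tame S A istar G q) (t : ℕ) : 0 ≤ S.fixedCost istar t :=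
  hT.cost_nonneg _ _ _

theorem fixedCost_le (hT : Tame S A istar G q) (t : ℕ) : S.fixedCost istar t ≤ 5 * G ^ 3 := by
  have hG := hT.one_le
  have h1 : ‖S.fixedState istar t‖ ^ 2 ≤ (2 * G) ^ 2 := by
    gcongr
    exact hT.norm_fixedState_le t
  calc S.fixedCost istar t ≤ G * (1 + ‖S.fixedState istar t‖ ^ 2) := hT.cost_le _ _ _
    _ ≤ G * (1 + (2 * G) ^ 2) := by gcongr
    _ ≤ _ := by nlinarith

/-- Cost of a batch under the stabilizing controller, compared with its stationary cost. -/
theorem batchCost_star_le (hT : Tame S A istar G q) (b : ℕ) (st : State n N) :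
    batchCost S A b st istar ≤
      ∑ j ∈ Finset.range (A.τ b), S.fixedCost istar (st.t + j) +
        32 * G ^ 3 * decaySum A.β (A.τ b) * (1 + ‖st.x‖ ^ 4) := by
  have hG := hT.one_le
  have hx := norm_nonneg st.x
  have hlen := batchLen_of_not_breaks (hT.not_breaks_star b st)
  have h1 : ∀ j ∈ Finset.range (A.τ b),
      S.cost (st.t + j) (batchState S st istar j) (S.ctrl istar (batchState S st istar j)) ≤
        S.fixedCost istar (st.t + j) + 32 * G ^ 3 * (1 + ‖st.x‖ ^ 4) * A.β j := by
    intro j hj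
    have hβ := hT.decay.nonneg j
    have h2 := hT.norm_batchState_le' (hlen ▸ Finset.mem_range.1 hj)
    have h3 := hT.cost_sub_le (st.t + j) istar (batchState S st istar j)
      (S.fixedState istar (st.t + j))
    have h4 := hT.norm_fixedState_le (st.t + j)
    have h5 : ‖batchState S st istar j - S.fixedState istar (st.t + j)‖ ≤
        A.β j * (2 * G * (1 + ‖st.x‖)) := by
      -- Incremental stability compares two trajectories of the comparator under the same
      -- disturbances, started at time `t_b` from the algorithm's state and from the comparator's
      -- own.
      have h6 := hT.star.2 st.x (S.fixedState istar st.t) (fun i => S.noise (st.t + i))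
        (fun i => hT.noise _) j
      have h7 : S.fixedState istar (st.t + j) = closedLoop S.f (S.ctrl istar)
          (fun i => S.noise (st.t + i)) (S.fixedState istar st.t) j :=
        closedLoop_add _ _ _ _ _ _
      rw [h7]
      refine h6.trans (mul_le_mul_of_nonneg_left ?_ hβ)
      have h8 := norm_sub_le st.x (S.fixedState istar st.t)
      have h9 := hT.norm_fixedState_le st.t
      nlinarith
    have h10 : 1 + ‖batchState S st istar j‖ + ‖S.fixedState istar (st.t + j)‖ ≤
        4 * G * (1 + ‖st.x‖) := by nlinarith
    have h11 : G * (1 + ‖batchState S st istar j‖ + ‖S.fixedState istar (st.t + j)‖) *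
        ‖batchState S st istar j - S.fixedState istar (st.t + j)‖ ≤
        G * (4 * G * (1 + ‖st.x‖)) * (A.β j * (2 * G * (1 + ‖st.x‖))) := by gcongr
    -- Quadratic growth would suffice; the fourth power lets this term share one sum with the
    -- squared batch costs.
    have h12 : (1 + ‖st.x‖) ^ 2 ≤ 4 * (1 + ‖st.x‖ ^ 4) := by
      nlinarith [sq_nonneg (‖st.x‖ - 1), sq_nonneg (‖st.x‖ ^ 2 - 1)]
    have h13 : 8 * G ^ 3 * A.β j * (1 + ‖st.x‖) ^ 2 ≤
        8 * G ^ 3 * A.β j * (4 * (1 + ‖st.x‖ ^ 4)) := by gcongr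
    have h14 : S.fixedCost istar (st.t + j) = S.cost (st.t + j) (S.fixedState istar (st.t + j))
      (S.ctrl istar (S.fixedState istar (st.t + j))) := rfl
    nlinarith
  rw [batchCost, hlen]
  refine (Finset.sum_le_sum h1).trans (le_of_eq ?_)
  rw [Finset.sum_add_distrib, ← Finset.mul_sum, decaySum]
  ring

section Sums

variable {κ : ℕ → Fin N}

theorem path_invariant (hT : Tame S A istar G q) (hv : ∀ b, Valid S A (history κ b)) (b : ℕ) :
    Invariant S A G b (path S A κ b) := by
  have := hT.invariant (hv b)
  rwa [length_history] at this

open Classical in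
theorem path_μ_succ (hv : ∀ b, Valid S A (history κ b)) (b : ℕ) :
    (path S A κ (b + 1)).μ =
      (path S A κ b).μ + if Breaks S A b (path S A κ b) (κ b) then 1 else 0 := by
  have h := nextState_μ (S := S) (A := A) (h := history κ b) (st := path S A κ b) (hv (b + 1)).1
  rwa [length_history] at h

theorem norm_path_le (hT : Tame S A istar G q) (hv : ∀ b, Valid S A (history κ b)) (b : ℕ) :
    ‖(path S A κ b).x‖ ≤ stateBound G (S.destabilizing A.β A.γ).ncard := by
  have hG := hT.one_le
  have h1 := (hT.path_invariant hv b).bound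
  have h2 : (3 * G ^ 2) ^ (path S A κ b).μ ≤ (3 * G ^ 2) ^ (S.destabilizing A.β A.γ).ncard :=
    pow_le_pow_right₀ (by nlinarith) (hT.path_invariant hv b).μ_le
  have h3 := mul_le_mul_of_nonneg_left h2 (show 0 ≤ 2 * G by linarith)
  rw [stateBound]
  linarith

/-- By convexity of the fourth power, a batch without falsification contracts `‖x‖⁴` up to `G⁴`;
each of the at most `U` falsified ones is charged `stateBound⁴`. Thus `e^{O(U)}` enters additively
instead of multiplying `B`. -/
theorem sum_norm_pow_le (hT : Tame S A istar G q) (hv : ∀ b, Valid S A (history κ b)) (B : ℕ) :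
    2 / 5 * ∑ b ∈ Finset.range B, ‖(path S A κ b).x‖ ^ 4 ≤
      G ^ 4 + B * G ^ 4 + stateBound G (S.destabilizing A.β A.γ).ncard ^ 4 *
        (S.destabilizing A.β A.γ).ncard := by
  have hG := hT.one_le
  have hq := hT.factor_nonneg
  have hq1 : 0 ≤ 1 - q := by linarith [hT.factor_le]
  set U := (S.destabilizing A.β A.γ).ncard with hU
  set X := stateBound G U with hX
  have hX0 : 0 ≤ X := (norm_nonneg _).trans (hT.norm_path_le hv 0)
  have hδ := hT.offset_nonneg
  refine (sum_le_of_contraction (μ := fun b => (path S A κ b).μ) (c := G ^ 4) (d := X ^ 4)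
    hT.factor_le (fun b => by positivity) fun b _ => ?_).trans ?_
  · have hx := norm_nonneg (path S A κ b).x
    rw [path_μ_succ hv]
    split_ifs with hb
    · have h1 : ‖(path S A κ (b + 1)).x‖ ^ 4 ≤ X ^ 4 := by
        gcongr
        exact hT.norm_path_le hv _
      push_cast
      have : 0 ≤ q * ‖(path S A κ b).x‖ ^ 4 + G ^ 4 := by positivity
      linarith
    · have h1 := hT.norm_endState_of_not_breaks hb
      rw [← path_x_succ] at h1
      have h2 : ‖(path S A κ (b + 1)).x‖ ^ 4 ≤ (q * ‖(path S A κ b).x‖ + (1 - q) * A.δ) ^ 4 := by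
        gcongr
      have h3 := (convexOn_pow 4).2 (Set.mem_Ici.2 hx) (Set.mem_Ici.2 hδ) hq hq1 (by ring)
      simp only [smul_eq_mul] at h3
      have h4 : A.δ ^ 4 ≤ G ^ 4 := by
        gcongr
        exact hT.offset_le
      have h5 : (1 - q) * A.δ ^ 4 ≤ 1 * G ^ 4 := by
        gcongr
        linarith
      simp only [add_zero, sub_self, mul_zero]
      linarith
  · have h0 : ‖(path S A κ 0).x‖ ^ 4 ≤ G ^ 4 := by
      gcongr
      exact hT.start_le
    have h1 : ((path S A κ B).μ : ℝ) - (path S A κ 0).μ ≤ U := by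
      have : ((path S A κ B).μ : ℝ) ≤ U := by exact_mod_cast (hT.path_invariant hv B).μ_le
      have : (0 : ℝ) ≤ (path S A κ 0).μ := by positivity
      linarith
    have := mul_le_mul_of_nonneg_left h1 (pow_nonneg hX0 4)
    linarith

/-- There are few batches of positive level. -/
theorem sum_positive_level_le (hT : Tame S A istar G q) (hv : ∀ b, Valid S A (history κ b))
    (B : ℕ) :
    ∑ b ∈ Finset.range B, (if (path S A κ b).s ≠ 0 then (1 : ℝ) else 0) ≤
      G * (5 / 2 * (G + stateBound G (S.destabilizing A.β A.γ).ncard *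
        (S.destabilizing A.β A.γ).ncard)) := by
  have hG := hT.one_le
  have hq := hT.factor_nonneg
  set U := (S.destabilizing A.β A.γ).ncard with hU
  set X := stateBound G U with hX
  have hX0 : 0 ≤ X := (norm_nonneg _).trans (hT.norm_path_le hv 0)
  have hδ := hT.offset_nonneg
  -- The excess over `δ` contracts without an additive term, so its sum does not grow with `B`; at
  -- positive levels it is at least `‖x0‖ ≥ 1 / G`.
  set a : ℕ → ℝ := fun b => max (‖(path S A κ b).x‖ - A.δ) 0 with ha
  have ha0 : ∀ b, 0 ≤ a b := fun b => le_max_right _ _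
  have h1 : 2 / 5 * ∑ b ∈ Finset.range B, a b ≤ a 0 + B * 0 +
      X * (((path S A κ B).μ : ℝ) - (path S A κ 0).μ) := by
    refine sum_le_of_contraction (μ := fun b => (path S A κ b).μ) hT.factor_le ha0 fun b _ => ?_
    rw [path_μ_succ hv]
    have h4 := mul_nonneg hq (ha0 b)
    split_ifs with hb
    · have h1 := hT.norm_path_le hv (b + 1)
      push_cast
      refine max_le ?_ ?_ <;> linarith
    · have h1 := hT.norm_endState_of_not_breaks hb
      rw [← path_x_succ] at h1
      have h2 := mul_le_mul_of_nonneg_left (le_max_left (‖(path S A κ b).x‖ - A.δ) 0) hq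
      simp only [add_zero, sub_self, mul_zero]
      refine max_le ?_ h4
      linarith
  have h2 : a 0 ≤ G := by
    have : ‖(path S A κ 0).x‖ ≤ G := hT.start_le
    refine max_le ?_ ?_ <;> linarith
  have h3 : ((path S A κ B).μ : ℝ) - (path S A κ 0).μ ≤ U := by
    have : ((path S A κ B).μ : ℝ) ≤ U := by exact_mod_cast (hT.path_invariant hv B).μ_le
    have : (0 : ℝ) ≤ (path S A κ 0).μ := by positivity
    linarith
  have h4 := mul_le_mul_of_nonneg_left h3 hX0
  have h5 : ∀ b ∈ Finset.range B, (if (path S A κ b).s ≠ 0 then (1 : ℝ) else 0) ≤ G * a b := by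
    intro b _
    split_ifs with hs
    · have h6 : ‖S.x0‖ ≤ a b := ((hT.path_invariant hv b).high hs).trans (le_max_left _ _)
      exact hT.le_start.trans (mul_le_mul_of_nonneg_left h6 (by linarith))
    · exact mul_nonneg (by linarith) (ha0 b)
  refine (Finset.sum_le_sum h5).trans ?_
  rw [← Finset.mul_sum]
  refine mul_le_mul_of_nonneg_left ?_ (by linarith)
  linarith

theorem sum_batchCost_positive_level_le (hT : Tame S A istar G q)
    (hv : ∀ b, Valid S A (history κ b)) (B T : ℕ) :
    ∑ b ∈ Finset.range B, (if (path S A κ b).t ≤ T ∧ (path S A κ b).s ≠ 0 then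
        batchCost S A b (path S A κ b) (κ b) else 0) ≤
      3 * G ^ 3 * A.τ B * (1 + stateBound G (S.destabilizing A.β A.γ).ncard ^ 2) *
        (G * (5 / 2 * (G + stateBound G (S.destabilizing A.β A.γ).ncard *
          (S.destabilizing A.β A.γ).ncard))) := by
  have hG := hT.one_le
  refine le_trans ?_ (mul_le_mul_of_nonneg_left (hT.sum_positive_level_le hv B) (by positivity))
  rw [Finset.mul_sum]
  refine Finset.sum_le_sum fun b hb => ?_
  split_ifs with h1 h2 h2
  · rw [mul_one]
    refine (hT.batchCost_le _ _ _).trans ?_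
    gcongr
    · exact hT.batch_mono (Finset.mem_range.1 hb).le
    · exact hT.norm_path_le hv b
  · exact absurd h1.2 h2
  · positivity
  · simp

theorem sum_sq_batchCost_le (hT : Tame S A istar G q)
    (hv : ∀ b, Valid S A (history κ b)) (B T : ℕ) :
    ∑ b ∈ Finset.range B, (if (path S A κ b).t ≤ T ∧ (path S A κ b).s = 0 then
        rate A (path S A κ b) / 2 *
          ∑ k ∈ (path S A κ b).P, batchCost S A b (path S A κ b) k ^ 2 else 0) ≤
      9 * G ^ 6 * (A.η0 * ((S.destabilizing A.β A.γ).ncard + 1 : ℝ) ^ (1 / 2 : ℝ)) * N *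
        (A.τ B : ℝ) ^ 2 * ∑ b ∈ Finset.range B, (1 + ‖(path S A κ b).x‖ ^ 4) := by
  have hG := hT.one_le
  have hη := hT.rate_pos
  rw [Finset.mul_sum]
  refine Finset.sum_le_sum fun b hb => ?_
  set st := path S A κ b
  have hτ : (A.τ b : ℝ) ≤ A.τ B := by exact_mod_cast hT.batch_mono (Finset.mem_range.1 hb).le
  split_ifs with h1
  · have h2 : ∀ k ∈ st.P, batchCost S A b st k ^ 2 ≤
        18 * G ^ 6 * (A.τ B : ℝ) ^ 2 * (1 + ‖st.x‖ ^ 4) := by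
      intro k _
      have h3 := hT.batchCost_le b st k
      have h4 : batchCost S A b st k ^ 2 ≤ (3 * G ^ 3 * A.τ B * (1 + ‖st.x‖ ^ 2)) ^ 2 := by
        have := hT.batchCost_nonneg b st k
        gcongr
        exact h3.trans (by gcongr)
      have h5 : (1 + ‖st.x‖ ^ 2) ^ 2 ≤ 2 * (1 + ‖st.x‖ ^ 4) := by
        nlinarith [sq_nonneg (‖st.x‖ ^ 2 - 1)]
      calc _ ≤ 9 * G ^ 6 * (A.τ B : ℝ) ^ 2 * (1 + ‖st.x‖ ^ 2) ^ 2 := h4.trans_eq (by ring)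
        _ ≤ 9 * G ^ 6 * (A.τ B : ℝ) ^ 2 * (2 * (1 + ‖st.x‖ ^ 4)) := by gcongr
        _ = _ := by ring
    have h6 : ∑ k ∈ st.P, batchCost S A b st k ^ 2 ≤
        N * (18 * G ^ 6 * (A.τ B : ℝ) ^ 2 * (1 + ‖st.x‖ ^ 4)) := by
      refine (Finset.sum_le_card_nsmul _ _ _ h2).trans ?_
      rw [nsmul_eq_mul]
      gcongr
      exact (Finset.card_le_univ _).trans_eq (Fintype.card_fin N)
    have h7 : rate A st ≤ A.η0 * ((S.destabilizing A.β A.γ).ncard + 1 : ℝ) ^ (1 / 2 : ℝ) := by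
      rw [rate_of_level_zero h1.2, hT.exponent]
      gcongr
      exact (hT.path_invariant hv b).μ_le
    calc _ ≤ A.η0 * ((S.destabilizing A.β A.γ).ncard + 1 : ℝ) ^ (1 / 2 : ℝ) / 2 *
          (N * (18 * G ^ 6 * (A.τ B : ℝ) ^ 2 * (1 + ‖st.x‖ ^ 4))) := by
          gcongr
      _ = _ := by ring
  · positivity

/-- The comparator is charged for `τ_b` rounds per batch, while the actual batches tile the time
axis. The two differ in the at most `U` falsified batches and by the overshoot beyond `T`, each
worth at most `5 G³ τ_B`: hence the factor `U + 1`. -/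
theorem sum_batchCost_star_le (hT : Tame S A istar G q)
    (hv : ∀ b, Valid S A (history κ b)) (B T : ℕ) :
    ∑ b ∈ Finset.range B, (if (path S A κ b).t ≤ T ∧ (path S A κ b).s = 0 then
        batchCost S A b (path S A κ b) istar else 0) ≤
      ∑ t ∈ Finset.range (T + 1), S.fixedCost istar t +
        5 * G ^ 3 * A.τ B * ((S.destabilizing A.β A.γ).ncard + 1) +
        32 * G ^ 3 * decaySum A.β (A.τ B) *
          ∑ b ∈ Finset.range B, (1 + ‖(path S A κ b).x‖ ^ 4) := by
  have hG := hT.one_le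
  set F := fun t => S.fixedCost istar t
  have hF : ∀ t, 0 ≤ F t := hT.fixedCost_nonneg
  have hF' : ∀ t, F t ≤ 5 * G ^ 3 := hT.fixedCost_le
  have hsum : ∀ a l : ℕ, ∑ j ∈ Finset.range l, F (a + j) ≤ l * (5 * G ^ 3) := fun a l => by
    refine (Finset.sum_le_card_nsmul _ _ _ fun j _ => hF' (a + j)).trans_eq ?_
    rw [nsmul_eq_mul, Finset.card_range]
  have h1 : ∀ b ∈ Finset.range B, (if (path S A κ b).t ≤ T ∧ (path S A κ b).s = 0 then
      batchCost S A b (path S A κ b) istar else 0) ≤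
      (if (path S A κ b).t ≤ T then ∑ j ∈ Finset.range (batchLen S A b (path S A κ b) (κ b)),
        F ((path S A κ b).t + j) else 0) +
      A.τ B * (5 * G ^ 3) * (((path S A κ (b + 1)).μ : ℝ) - (path S A κ b).μ) +
      32 * G ^ 3 * decaySum A.β (A.τ B) * (1 + ‖(path S A κ b).x‖ ^ 4) := by
    intro b hb
    have hτ := hT.batch_mono (Finset.mem_range.1 hb).le
    have hτ' : (A.τ b : ℝ) ≤ A.τ B := by exact_mod_cast hτ
    have hd := decaySum_mono hT.decay hτ
    have hd0 := decaySum_nonneg hT.decay (A.τ B)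
    have h2 : 32 * G ^ 3 * decaySum A.β (A.τ b) * (1 + ‖(path S A κ b).x‖ ^ 4) ≤
      32 * G ^ 3 * decaySum A.β (A.τ B) * (1 + ‖(path S A κ b).x‖ ^ 4) := by gcongr
    have h0 : 0 ≤ 32 * G ^ 3 * decaySum A.β (A.τ B) * (1 + ‖(path S A κ b).x‖ ^ 4) := by
      positivity
    have h3 : ∑ j ∈ Finset.range (A.τ b), F ((path S A κ b).t + j) ≤
        ∑ j ∈ Finset.range (batchLen S A b (path S A κ b) (κ b)), F ((path S A κ b).t + j) +
        A.τ B * (5 * G ^ 3) * (((path S A κ (b + 1)).μ : ℝ) - (path S A κ b).μ) := by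
      rw [path_μ_succ hv]
      split_ifs with hbr
      · have h4 := hsum (path S A κ b).t (A.τ b)
        have h5 : (A.τ b : ℝ) * (5 * G ^ 3) ≤ A.τ B * (5 * G ^ 3) := by gcongr
        have h6 : 0 ≤ ∑ j ∈ Finset.range (batchLen S A b (path S A κ b) (κ b)),
          F ((path S A κ b).t + j) := Finset.sum_nonneg fun _ _ => hF _
        push_cast
        linarith
      · rw [batchLen_of_not_breaks hbr]
        simp
    have hμ0 : 0 ≤ A.τ B * (5 * G ^ 3) * (((path S A κ (b + 1)).μ : ℝ) - (path S A κ b).μ) := by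
      rw [path_μ_succ hv]
      push_cast
      rw [add_sub_cancel_left]
      positivity
    by_cases ht : (path S A κ b).t ≤ T
    · rw [if_pos ht]
      split_ifs with hs
      · have := hT.batchCost_star_le b (path S A κ b)
        linarith
      · have h6 : 0 ≤ ∑ j ∈ Finset.range (batchLen S A b (path S A κ b) (κ b)),
          F ((path S A κ b).t + j) := Finset.sum_nonneg fun _ _ => hF _
        linarith
    · rw [if_neg ht, if_neg fun h => ht h.1]
      linarith
  -- A batch that starts by time `T` ends at most `τ_B` rounds later.
  have h2 : ∀ B' ≤ B, ∑ b ∈ Finset.range B', (if (path S A κ b).t ≤ T then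
      ∑ j ∈ Finset.range (batchLen S A b (path S A κ b) (κ b)),
        F ((path S A κ b).t + j) else 0) ≤
      ∑ t ∈ Finset.range (min (path S A κ B').t (T + 1 + A.τ B)), F t := by
    intro B'
    induction B' with
    | zero => simp [path, history, run]
    | succ b ih =>
      intro hb
      have ih := ih (by omega)
      have h3 := path_t_succ (S := S) (A := A) κ b
      have h4 := batchLen_le (S := S) (A := A) b (path S A κ b) (κ b)
      have h5 := hT.batch_mono (show b ≤ B by omega)
      rw [Finset.sum_range_succ]
      split_ifs with ht
      · rw [min_eq_left (by omega)] at ih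
        rw [min_eq_left (by omega), h3, Finset.sum_range_add]
        linarith
      · rw [add_zero]
        refine ih.trans (Finset.sum_le_sum_of_subset_of_nonneg (Finset.range_mono ?_)
          fun _ _ _ => hF _)
        exact min_le_min_right _ (by omega)
  have h3 : ∑ t ∈ Finset.range (min (path S A κ B).t (T + 1 + A.τ B)), F t ≤
      ∑ t ∈ Finset.range (T + 1), F t + A.τ B * (5 * G ^ 3) := by
    refine (Finset.sum_le_sum_of_subset_of_nonneg (Finset.range_mono (min_le_right _ _))
      fun _ _ _ => hF _).trans ?_
    rw [Finset.sum_range_add]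
    have := hsum (T + 1) (A.τ B)
    linarith
  have h4 : ((path S A κ B).μ : ℝ) - (path S A κ 0).μ ≤ (S.destabilizing A.β A.γ).ncard := by
    have : ((path S A κ B).μ : ℝ) ≤ (S.destabilizing A.β A.γ).ncard := by
      exact_mod_cast (hT.path_invariant hv B).μ_le
    have : (0 : ℝ) ≤ (path S A κ 0).μ := by positivity
    linarith
  have h5 := mul_le_mul_of_nonneg_left h4 (show 0 ≤ A.τ B * (5 * G ^ 3) by positivity)
  refine (Finset.sum_le_sum h1).trans ?_
  rw [Finset.sum_add_distrib, Finset.sum_add_distrib, ← Finset.mul_sum, ← Finset.mul_sum,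
    Finset.sum_range_sub (fun b => ((path S A κ b).μ : ℝ))]
  have h6 := h2 B le_rfl
  linarith

end Sums

end Tame

end Path

/-! ### Expectations over the sampled controllers -/

section Expectation

variable {n m g N : ℕ} {S : Problem n m g N} {A : Input N} {istar : Fin N} {G q : ℝ}

theorem history_inj {κ κ' : ℕ → Fin N} {b : ℕ} (h : history κ b = history κ' b) {i : ℕ}
    (hi : i < b) : κ i = κ' i := by
  induction b with
  | zero => omega
  | succ b ih =>
    rw [history, history, List.cons.injEq] at h
    rcases Nat.lt_succ_iff_lt_or_eq.1 hi with h1 | rfl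
    · exact ih h.2 h1
    · exact h.1

theorem history_congr {κ κ' : ℕ → Fin N} {b : ℕ} (h : ∀ i < b, κ i = κ' i) :
    history κ b = history κ' b := by
  induction b with
  | zero => rfl
  | succ b ih =>
    rw [history, history, h b (Nat.lt_succ_self b), ih fun i hi => h i (by omega)]

theorem batchAt_congr {κ κ' : ℕ → Fin N} {t : ℕ} (h : ∀ i < t, κ i = κ' i) :
    batchAt S A κ t = batchAt S A κ' t := by
  have hh : ∀ b ≤ t, history κ b = history κ' b := fun b hb =>
    history_congr fun i hi => h i (by omega)
  rw [batchAt, Nat.findGreatest_eq_iff, batchAt]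
  set c := Nat.findGreatest (fun b => (run S A (history κ' b)).t ≤ t) t with hc
  obtain ⟨h1, h2, h3⟩ := (Nat.findGreatest_eq_iff).1 hc.symm
  refine ⟨h1, fun h0 => ?_, fun i hi hit => ?_⟩
  · rw [hh _ h1]; exact h2 h0
  · rw [hh _ hit]; exact h3 hi hit

theorem batchAt_le (κ : ℕ → Fin N) (t : ℕ) : batchAt S A κ t ≤ t := Nat.findGreatest_le t

/-- `batchAt` searches only up to `t`, so the state at time `t` is determined by the first `t + 1`
choices; this makes the regret integrand a function of a finite history. -/
theorem algState_congr {κ κ' : ℕ → Fin N} {t : ℕ} (h : ∀ i ≤ t, κ i = κ' i) :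
    algState S A κ t = algState S A κ' t := by
  have h1 := batchAt_congr (S := S) (A := A) fun i (hi : i < t) => h i hi.le
  have h2 := batchAt_le (S := S) (A := A) κ' t
  simp only [algState, h1, h _ h2,
    history_congr fun i (hi : i < batchAt S A κ' t) => h i (by omega)]

theorem algAction_congr {κ κ' : ℕ → Fin N} {t : ℕ} (h : ∀ i ≤ t, κ i = κ' i) :
    algAction S A κ t = algAction S A κ' t := by
  have h1 := batchAt_congr (S := S) (A := A) fun i (hi : i < t) => h i hi.le
  have h2 := batchAt_le (S := S) (A := A) κ' t
  rw [algAction, algAction, algState_congr h, h1, h _ h2]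

section Integrals

variable {Ω : Type*} [MeasurableSpace Ω] {P : Measure Ω} {K : ℕ → Ω → Fin N}

theorem measurableSet_history (hK : ∀ b, Measurable (K b)) (b : ℕ) (h : List (Fin N)) :
    MeasurableSet {ω | history (fun b => K b ω) b = h} := by
  induction b generalizing h with
  | zero => simp [history]
  | succ b ih =>
    cases h with
    | nil => simp [history]
    | cons k h =>
      simp only [history, List.cons.injEq]
      exact (hK b (measurableSet_singleton k)).inter (ih h)

/-- The histories of length `b`. -/
noncomputable def histories (N b : ℕ) : Finset (List (Fin N)) :=
  (List.finite_length_eq (Fin N) b).toFinset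

theorem mem_histories {b : ℕ} {h : List (Fin N)} : h ∈ histories N b ↔ h.length = b := by
  simp [histories]

theorem sum_histories_succ (b : ℕ) (F : List (Fin N) → ℝ) :
    ∑ h ∈ histories N (b + 1), F h = ∑ h ∈ histories N b, ∑ k, F (k :: h) := by
  rw [← Finset.sum_product']
  symm
  refine Finset.sum_nbij (fun p => p.2 :: p.1) ?_ ?_ ?_ ?_
  · rintro ⟨h, k⟩ hp
    simp only [Finset.mem_product, mem_histories, Finset.mem_univ, and_true] at hp
    simp [mem_histories, hp]
  · rintro ⟨h, k⟩ _ ⟨h', k'⟩ _ heq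
    simp only [List.cons.injEq] at heq
    simp [heq.1, heq.2]
  · rintro l hl
    have hl' := mem_histories.1 hl
    cases l with
    | nil => simp at hl'
    | cons k h =>
      refine ⟨(h, k), ?_, rfl⟩
      simp only [List.length_cons, Nat.add_right_cancel_iff] at hl'
      simp [mem_histories, hl']
  · rintro _ _
    rfl

theorem apply_history_eq_sum (κ : ℕ → Fin N) (b : ℕ) (F : List (Fin N) → ℝ) :
    F (history κ b) = ∑ h ∈ histories N b, if history κ b = h then F h else 0 := by
  rw [Finset.sum_ite_eq, if_pos (mem_histories.2 (length_history κ b))]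

variable [IsProbabilityMeasure P]

theorem ite_history_eq_indicator {Ω : Type*} {K : ℕ → Ω → Fin N} (b : ℕ) (h : List (Fin N)) (c : ℝ) :
    (fun ω => if history (fun b => K b ω) b = h then c else 0) =
      {ω | history (fun b => K b ω) b = h}.indicator fun _ => c := by
  ext ω
  by_cases hω : history (fun b => K b ω) b = h <;> simp [hω]

theorem integrable_ite_history (hK : ∀ b, Measurable (K b)) (b : ℕ) (h : List (Fin N)) (c : ℝ) :
    Integrable (fun ω => if history (fun b => K b ω) b = h then c else 0) P :=
  ite_history_eq_indicator (K := K) b h c ▸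
    (integrable_const c).indicator (measurableSet_history hK b h)

theorem integrable_apply_history (hK : ∀ b, Measurable (K b)) (b : ℕ) (F : List (Fin N) → ℝ) :
    Integrable (fun ω => F (history (fun b => K b ω) b)) P := by
  simp only [apply_history_eq_sum _ b F]
  exact integrable_finsetSum _ fun h _ => integrable_ite_history hK b h _

/-- A function of finitely many choices from a finite pool takes finitely many values.
`Function.extend` turns it into a function on lists. -/
theorem integrable_of_history (hK : ∀ b, Measurable (K b)) (b : ℕ) {F : (ℕ → Fin N) → ℝ}
    (hF : ∀ κ κ', history κ b = history κ' b → F κ = F κ') :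
    Integrable (fun ω => F fun b => K b ω) P := by
  have hfac : Function.FactorsThrough F (fun κ : ℕ → Fin N => history κ b) :=
    fun κ κ' h => hF κ κ' h
  have := integrable_apply_history (P := P) hK b
    (Function.extend (fun κ : ℕ → Fin N => history κ b) F 0)
  simpa only [hfac.extend_apply (0 : List (Fin N) → ℝ)] using this

theorem integral_apply_history (hK : ∀ b, Measurable (K b)) (b : ℕ) (F : List (Fin N) → ℝ) :
    ∫ ω, F (history (fun b => K b ω) b) ∂P =
      ∑ h ∈ histories N b, P.real {ω | history (fun b => K b ω) b = h} * F h := by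
  simp only [apply_history_eq_sum _ b F]
  rw [integral_finsetSum _ fun h _ => integrable_ite_history hK b h _]
  refine Finset.sum_congr rfl fun h _ => ?_
  rw [ite_history_eq_indicator, integral_indicator_const _ (measurableSet_history hK b h),
    smul_eq_mul]

/-- The tower property given the history, as a finite sum over histories, so that no conditional
expectation is needed. -/
theorem IsSampled.integral_succ (hK : IsSampled S A P K) (b : ℕ) (F : List (Fin N) → ℝ) :
    ∫ ω, F (history (fun b => K b ω) (b + 1)) ∂P =
      ∫ ω, ∑ k, prob A (run S A (history (fun b => K b ω) b)) k *
        F (k :: history (fun b => K b ω) b) ∂P := by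
  rw [integral_apply_history hK.measurable, sum_histories_succ,
    integral_apply_history hK.measurable b fun h => ∑ k, prob A (run S A h) k * F (k :: h)]
  refine Finset.sum_congr rfl fun h hh => ?_
  obtain rfl := mem_histories.1 hh
  rw [Finset.mul_sum]
  refine Finset.sum_congr rfl fun k _ => ?_
  rw [hK.law, mul_assoc]

/-- A controller outside the pool is drawn with probability 0, and there are only countably many
histories. -/
theorem IsSampled.ae_valid (hK : IsSampled S A P K) :
    ∀ᵐ ω ∂P, ∀ b, Valid S A (history (fun b => K b ω) b) := by
  have h1 : ∀ (h : List (Fin N)) (k : Fin N), k ∉ (run S A h).P →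
      ∀ᵐ ω ∂P, history (fun b => K b ω) (h.length + 1) ≠ k :: h := by
    intro h k hk
    have h2 := hK.law h k
    rw [prob_of_notMem hk, mul_zero, measureReal_eq_zero_iff] at h2
    rw [ae_iff]
    simpa using h2
  have h3 : ∀ᵐ ω ∂P, ∀ (h : List (Fin N)) (k : Fin N), k ∉ (run S A h).P →
      history (fun b => K b ω) (h.length + 1) ≠ k :: h := by
    rw [ae_all_iff]; intro h
    rw [ae_all_iff]; intro k
    by_cases hk : k ∈ (run S A h).P
    · exact Eventually.of_forall fun ω h' => absurd hk h'
    · exact (h1 h k hk).mono fun ω hω _ => hω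
  filter_upwards [h3] with ω hω b
  induction b with
  | zero => trivial
  | succ b ih =>
    refine ⟨?_, ih⟩
    by_contra hk
    exact hω _ _ hk (by rw [length_history]; rfl)

/-- The regret is at most the initial potential plus a pathwise bound for the batches of positive
level, the excess cost of the stabilizing controller, and the second-order terms. -/
theorem Tame.regret_le (hT : Tame S A istar G q) (hK : IsSampled S A P K) {B T : ℕ} {R : ℝ}
    (hB : ∀ κ, (∀ b, Valid S A (history κ b)) → T < (path S A κ B).t)
    (hR : ∀ κ, (∀ b, Valid S A (history κ b)) →
      ∑ b ∈ Finset.range B, (if (path S A κ b).t ≤ T ∧ (path S A κ b).s ≠ 0 then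
        batchCost S A b (path S A κ b) (κ b) else 0) +
      ∑ b ∈ Finset.range B, (if (path S A κ b).t ≤ T ∧ (path S A κ b).s = 0 then
        batchCost S A b (path S A κ b) istar + rate A (path S A κ b) / 2 *
          ∑ k ∈ (path S A κ b).P, batchCost S A b (path S A κ b) k ^ 2 else 0) ≤
      ∑ t ∈ Finset.range (T + 1), S.fixedCost istar t + R) :
    regret S A P K T istar ≤
      potential A istar (S.destabilizing A.β A.γ).ncard T (run S A []) + R := by
  set U := (S.destabilizing A.β A.γ).ncard
  set X : ℕ → (ℕ → Fin N) → ℝ := fun b κ =>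
    if (path S A κ b).t ≤ T ∧ (path S A κ b).s = 0 then
      batchCost S A b (path S A κ b) (κ b) else 0 with hX
  set Z : ℕ → (ℕ → Fin N) → ℝ := fun b κ =>
    if (path S A κ b).t ≤ T ∧ (path S A κ b).s ≠ 0 then
      batchCost S A b (path S A κ b) (κ b) else 0 with hZ
  set Y : ℕ → (ℕ → Fin N) → ℝ := fun b κ =>
    if (path S A κ b).t ≤ T ∧ (path S A κ b).s = 0 then
      batchCost S A b (path S A κ b) istar + rate A (path S A κ b) / 2 *
        ∑ k ∈ (path S A κ b).P, batchCost S A b (path S A κ b) k ^ 2 else 0 with hY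
  set Φ : ℕ → (ℕ → Fin N) → ℝ := fun b κ => potential A istar U T (path S A κ b) with hΦ
  have hpath : ∀ {b c : ℕ} {κ κ' : ℕ → Fin N}, b ≤ c → history κ c = history κ' c →
      path S A κ b = path S A κ' b := fun hbc h => by
    rw [path, path, history_congr fun i hi => history_inj h (hi.trans_le hbc)]
  have iX : ∀ b, Integrable (fun ω => X b fun b => K b ω) P := fun b =>
    integrable_of_history hK.measurable (b + 1) fun κ κ' h => by
      simp only [hX, hpath b.le_succ h, history_inj h b.lt_succ_self]
  have iZ : ∀ b, Integrable (fun ω => Z b fun b => K b ω) P := fun b =>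
    integrable_of_history hK.measurable (b + 1) fun κ κ' h => by
      simp only [hZ, hpath b.le_succ h, history_inj h b.lt_succ_self]
  have iY : ∀ b, Integrable (fun ω => Y b fun b => K b ω) P := fun b =>
    integrable_of_history hK.measurable b fun κ κ' h => by
      simp only [hY, hpath le_rfl h]
  have iΦ : ∀ b, Integrable (fun ω => Φ b fun b => K b ω) P := fun b =>
    integrable_of_history hK.measurable b fun κ κ' h => by
      simp only [hΦ, hpath le_rfl h]
  have step : ∀ b, ∫ ω, X b (fun b => K b ω) ∂P + ∫ ω, Φ (b + 1) (fun b => K b ω) ∂P ≤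
      ∫ ω, Φ b (fun b => K b ω) ∂P + ∫ ω, Y b (fun b => K b ω) ∂P := by
    intro b
    rw [← integral_add (iX b) (iΦ (b + 1)), ← integral_add (iΦ b) (iY b)]
    -- The value at `[]` is a dummy: the histories that occur here have length `b + 1`.
    have h1 := hK.integral_succ b fun h => match h with
      | [] => 0
      | k :: h => (if (run S A h).t ≤ T ∧ (run S A h).s = 0 then
          batchCost S A h.length (run S A h) k else 0) + potential A istar U T (run S A (k :: h))
    simp only [history, length_history] at h1
    refine (le_of_eq h1).trans (integral_mono_ae ?_ ((iΦ b).add (iY b)) ?_)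
    · exact integrable_of_history hK.measurable b
        (F := fun κ => ∑ k, prob A (run S A (history κ b)) k *
          ((if (run S A (history κ b)).t ≤ T ∧ (run S A (history κ b)).s = 0 then
            batchCost S A b (run S A (history κ b)) k else 0) +
              potential A istar U T (run S A (k :: history κ b)))) fun κ κ' h => by
          simp only [h]
    · filter_upwards [hK.ae_valid] with ω hω
      have h2 := hT.expected_step (hT.invariant (hω b)) T
      rw [length_history] at h2
      exact h2
  have htel : ∀ B, ∑ b ∈ Finset.range B, ∫ ω, X b (fun b => K b ω) ∂P +
      ∫ ω, Φ B (fun b => K b ω) ∂P ≤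
      potential A istar U T (run S A []) + ∑ b ∈ Finset.range B, ∫ ω, Y b (fun b => K b ω) ∂P := by
    intro B
    induction B with
    | zero => simp [hΦ, path, history]
    | succ b ih =>
      rw [Finset.sum_range_succ, Finset.sum_range_succ]
      linarith [step b]
  have hΦB : 0 ≤ ∫ ω, Φ B (fun b => K b ω) ∂P := by
    refine integral_nonneg_of_ae ?_
    filter_upwards [hK.ae_valid] with ω hω
    exact hT.potential_nonneg (hT.path_invariant hω B) U T
  have iXs := integrable_finsetSum (Finset.range B) fun b _ => iX b
  have iYs := integrable_finsetSum (Finset.range B) fun b _ => iY b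
  have iZs := integrable_finsetSum (Finset.range B) fun b _ => iZ b
  set Ft := ∑ t ∈ Finset.range (T + 1), S.fixedCost istar t
  have hreg : regret S A P K T istar ≤
      ∫ ω, (∑ b ∈ Finset.range B, X b (fun b => K b ω) +
        ∑ b ∈ Finset.range B, Z b (fun b => K b ω) - Ft) ∂P := by
    refine integral_mono_ae ?_ ((iXs.add iZs).sub (integrable_const Ft)) ?_
    · refine integrable_of_history hK.measurable (T + 1)
        (F := fun κ => ∑ t ∈ Finset.range (T + 1),
          (S.cost t (algState S A κ t) (algAction S A κ t) - S.fixedCost istar t))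
        fun κ κ' h => Finset.sum_congr rfl fun t ht => ?_
      have ht' := Finset.mem_range.1 ht
      have hκ : ∀ i ≤ t, κ i = κ' i := fun i hi => history_inj h (by omega)
      rw [algState_congr hκ, algAction_congr hκ]
    · filter_upwards [hK.ae_valid] with ω hω
      rw [Finset.sum_sub_distrib]
      refine sub_le_sub_right ((hT.sum_cost_le _ (hB _ hω)).trans ?_) Ft
      rw [← Finset.sum_add_distrib]
      refine Finset.sum_le_sum fun b _ => ?_
      simp only [hX, hZ]
      by_cases h1 : (path S A (fun b => K b ω) b).t ≤ T <;>
        by_cases h2 : (path S A (fun b => K b ω) b).s = 0 <;> simp [h1, h2]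
  have hZY : ∫ ω, (∑ b ∈ Finset.range B, Z b (fun b => K b ω) +
      ∑ b ∈ Finset.range B, Y b (fun b => K b ω)) ∂P ≤ Ft + R := by
    have : ∫ _ω, (Ft + R) ∂P = Ft + R := by simp
    rw [← this]
    refine integral_mono_ae (iZs.add iYs) (integrable_const _) ?_
    filter_upwards [hK.ae_valid] with ω hω
    exact hR _ hω
  rw [integral_sub (f := fun ω => ∑ b ∈ Finset.range B, X b (fun b => K b ω) +
      ∑ b ∈ Finset.range B, Z b (fun b => K b ω)) (iXs.add iZs) (integrable_const Ft),
    integral_add iXs iZs,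
    integral_finsetSum (f := fun b ω => X b fun b => K b ω) _ fun b _ => iX b] at hreg
  rw [integral_add iZs iYs, integral_finsetSum (f := fun b ω => Y b fun b => K b ω) _
    fun b _ => iY b] at hZY
  have hFt : ∫ _ω, Ft ∂P = Ft := by simp
  linarith [htel B]

end Integrals

end Expectation

/-! ### Quantitative regret bound -/

section Quantitative

variable {n m g N : ℕ} {S : Problem n m g N} {A : Input N} {istar : Fin N} {G q : ℝ}

/-- The second bound absorbs a factor `U` into one more power of `stateBound`; this is how the fifth
powers below arise. -/
theorem le_stateBound {G : ℝ} (hG : 1 ≤ G) (U : ℕ) :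
    2 * G ≤ stateBound G U ∧ (U : ℝ) ≤ stateBound G U := by
  have h1 : (3 : ℝ) ^ U ≤ (3 * G ^ 2) ^ U := by
    gcongr
    nlinarith
  have h2 : (1 : ℝ) ≤ (3 * G ^ 2) ^ U := one_le_pow₀ (by nlinarith)
  have h3 : (U : ℝ) ≤ 3 ^ U := by exact_mod_cast (Nat.lt_pow_self (by norm_num : 1 < 3)).le
  unfold stateBound
  constructor <;> nlinarith

/-- The initial `log N / η₀` is the term `i = 0` missing from the restart price; together they form
the full sum of `sum_rsqrt_le`. -/
theorem Tame.potential_nil_le (hT : Tame S A istar G q) (U T : ℕ) :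
    potential A istar U T (run S A []) ≤
      2 * (Real.log N / A.η0) * ((U : ℝ) + 1) ^ (1 / 2 : ℝ) := by
  have hη := hT.rate_pos
  have hlog : 0 ≤ Real.log N / A.η0 := div_nonneg (Real.log_natCast_nonneg N) hη.le
  have hs : (run S A []).s = 0 := rfl
  have hrate : rate A (run S A []) = A.η0 := by
    rw [rate_of_level_zero hs]
    simp [run]
  have h1 : logPartition A.η0 (run S A []).P (run S A []).W ≤ Real.log N / A.η0 :=
    logPartition_zero_le hη ⟨istar, Finset.mem_univ _⟩ (by simp)
  have h2 := mul_le_mul_of_nonneg_left (sum_rsqrt_le U) hlog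
  rw [← Finset.sum_erase_add _ _ (Finset.mem_range.2 U.succ_pos)] at h2
  have h3 : (Finset.range (U + 1)).erase 0 = Finset.Ico 1 (U + 1) := by
    ext i
    simp only [Finset.mem_erase, Finset.mem_range, Finset.mem_Ico]
    omega
  have h4 : (run S A []).t ≤ T := Nat.zero_le T
  have h5 : (run S A []).W istar = 0 := rfl
  have h6 : (run S A []).μ = 0 := rfl
  rw [potential, if_pos h4, if_pos hs, hrate, h5, restartPrice, if_pos hs, h6]
  rw [h3] at h2
  simp only [Nat.cast_zero, zero_add, Real.one_rpow, div_one] at h2 ⊢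
  linarith

variable {Ω : Type*} [MeasurableSpace Ω] {P : Measure Ω} {K : ℕ → Ω → Fin N}
  [IsProbabilityMeasure P]

/-- Regret bound in terms of a bound `B` on the number of batches. -/
theorem Tame.regret_le_batches (hT : Tame S A istar G q) (hK : IsSampled S A P K) {B T U : ℕ}
    (hU : U = (S.destabilizing A.β A.γ).ncard) (hB0 : 1 ≤ B)
    (hB : T < ∑ i ∈ Finset.range (B - U), A.τ i) :
    regret S A P K T istar ≤
      2 * (Real.log N / A.η0) * ((U : ℝ) + 1) ^ (1 / 2 : ℝ) +
      40 * G ^ 4 * A.τ B * stateBound G U ^ 4 +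
      (9 * G ^ 6 * (A.η0 * ((U : ℝ) + 1) ^ (1 / 2 : ℝ)) * N * (A.τ B : ℝ) ^ 2 +
        32 * G ^ 3 * decaySum A.β (A.τ B)) *
        (B * (1 + 5 * G ^ 4) + 5 / 2 * stateBound G U ^ 5) := by
  subst hU
  have hG := hT.one_le
  have hη := hT.rate_pos
  obtain ⟨hX1, hX2⟩ := le_stateBound hG (S.destabilizing A.β A.γ).ncard
  set U := (S.destabilizing A.β A.γ).ncard with hU
  set X := stateBound G U with hX
  have hX0 : 1 ≤ X := by linarith
  have hd := decaySum_nonneg hT.decay (A.τ B)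
  rw [add_assoc]
  refine (hT.regret_le hK (B := B) (T := T) (R := 40 * G ^ 4 * A.τ B * X ^ 4 +
      (9 * G ^ 6 * (A.η0 * ((U : ℝ) + 1) ^ (1 / 2 : ℝ)) * N * (A.τ B : ℝ) ^ 2 +
        32 * G ^ 3 * decaySum A.β (A.τ B)) * (B * (1 + 5 * G ^ 4) + 5 / 2 * X ^ 5)) ?_ ?_).trans
    (add_le_add_left (hT.potential_nil_le U T) _)
  · intro κ hv
    have hI := hT.path_invariant hv B
    have hμ := hI.μ_le
    -- At most `U` of the `B` batches are cut short, so at least the first `B - U` lengths have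
    -- elapsed.
    refine hB.trans_le (le_trans ?_ hI.time)
    exact Finset.sum_le_sum_of_subset (Finset.range_mono (by omega))
  · intro κ hv
    have h1 := hT.sum_batchCost_positive_level_le hv B T
    have h2 := hT.sum_sq_batchCost_le hv B T
    have h3 := hT.sum_batchCost_star_le hv B T
    have h4 := hT.sum_norm_pow_le hv B
    rw [← hU, ← hX] at h1 h4
    rw [← hU] at h2 h3
    have hsplit : ∑ b ∈ Finset.range B, (if (path S A κ b).t ≤ T ∧ (path S A κ b).s = 0 then
        batchCost S A b (path S A κ b) istar + rate A (path S A κ b) / 2 *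
          ∑ k ∈ (path S A κ b).P, batchCost S A b (path S A κ b) k ^ 2 else 0) =
        ∑ b ∈ Finset.range B, (if (path S A κ b).t ≤ T ∧ (path S A κ b).s = 0 then
          batchCost S A b (path S A κ b) istar else 0) +
        ∑ b ∈ Finset.range B, (if (path S A κ b).t ≤ T ∧ (path S A κ b).s = 0 then
          rate A (path S A κ b) / 2 *
            ∑ k ∈ (path S A κ b).P, batchCost S A b (path S A κ b) k ^ 2 else 0) := by
      rw [← Finset.sum_add_distrib]
      refine Finset.sum_congr rfl fun b _ => ?_
      split_ifs <;> simp
    have hS4 : ∑ b ∈ Finset.range B, (1 + ‖(path S A κ b).x‖ ^ 4) ≤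
        B * (1 + 5 * G ^ 4) + 5 / 2 * X ^ 5 := by
      rw [Finset.sum_add_distrib, Finset.sum_const, Finset.card_range, nsmul_eq_mul, mul_one]
      have h5 : X ^ 4 * U ≤ X ^ 4 * X := by gcongr
      have h6 : (1 : ℝ) * G ^ 4 ≤ B * G ^ 4 := by
        gcongr
        exact_mod_cast hB0
      have h7 : X ^ 4 * X = X ^ 5 := by ring
      linarith
    have h5 : 3 * G ^ 3 * A.τ B * (1 + X ^ 2) * (G * (5 / 2 * (G + X * U))) ≤
        3 * G ^ 3 * A.τ B * (2 * X ^ 2) * (G * (5 / 2 * (2 * X ^ 2))) := by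
      have : 1 + X ^ 2 ≤ 2 * X ^ 2 := by nlinarith
      have : X * U ≤ X * X := by gcongr
      have : G + X * U ≤ 2 * X ^ 2 := by nlinarith
      gcongr
    have h6 : 5 * G ^ 3 * A.τ B * ((U : ℝ) + 1) ≤ 10 * G ^ 4 * A.τ B * X ^ 4 := by
      have h7 : (U : ℝ) + 1 ≤ 2 * X ^ 4 := by
        have : X ≤ X ^ 4 := le_self_pow₀ hX0 (by norm_num)
        linarith
      have h8 : G ^ 3 ≤ G ^ 4 := pow_le_pow_right₀ hG (by norm_num)
      calc _ ≤ 5 * G ^ 4 * A.τ B * (2 * X ^ 4) := by gcongr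
        _ = _ := by ring
    have h7 := mul_le_mul_of_nonneg_left hS4 (show
      0 ≤ 9 * G ^ 6 * (A.η0 * ((U : ℝ) + 1) ^ (1 / 2 : ℝ)) * N * (A.τ B : ℝ) ^ 2 +
        32 * G ^ 3 * decaySum A.β (A.τ B) by positivity)
    rw [hsplit]
    have h8 : 3 * G ^ 3 * A.τ B * (2 * X ^ 2) * (G * (5 / 2 * (2 * X ^ 2))) =
      30 * G ^ 4 * A.τ B * X ^ 4 := by ring
    linarith

end Quantitative

/-! ### Polynomial batches -/

section Batches

variable {N : ℕ} {z ν : ℝ}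

theorem polyBatch_sqrt_zero : polyBatch (1 / (N : ℝ) ^ (1 / 2 : ℝ)) z (1 / 2) ν 0 =
    ⌊√(z / N)⌋₊ := by
  rw [polyBatch, if_pos rfl, ← Real.sqrt_eq_rpow, ← Real.sqrt_eq_rpow,
    Real.sqrt_div' _ (Nat.cast_nonneg N)]
  congr 1
  ring

theorem polyBatch_sqrt {b : ℕ} (hb : b ≠ 0) : polyBatch (1 / (N : ℝ) ^ (1 / 2 : ℝ)) z (1 / 2) ν b =
    ⌈√((ν * b + z) / N)⌉₊ := by
  rw [polyBatch, if_neg hb, ← Real.sqrt_eq_rpow, ← Real.sqrt_eq_rpow,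
    Real.sqrt_div' _ (Nat.cast_nonneg N)]
  congr 1
  ring

theorem polyBatch_sqrt_mono (hν : 0 < ν) :
    Monotone (polyBatch (1 / (N : ℝ) ^ (1 / 2 : ℝ)) z (1 / 2) ν) := by
  refine monotone_nat_of_le_succ fun b => ?_
  rw [polyBatch_sqrt b.succ_ne_zero]
  rcases Nat.eq_zero_or_pos b with rfl | hb
  · rw [polyBatch_sqrt_zero]
    refine (Nat.floor_le_ceil _).trans ?_
    gcongr
    simp [hν.le]
  · rw [polyBatch_sqrt hb.ne']
    gcongr
    simp

theorem polyBatch_sqrt_le (b : ℕ) :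
    (polyBatch (1 / (N : ℝ) ^ (1 / 2 : ℝ)) z (1 / 2) ν b : ℝ) ≤ √((ν * b + z) / N) + 1 := by
  rcases Nat.eq_zero_or_pos b with rfl | hb
  · rw [polyBatch_sqrt_zero, Nat.cast_zero, mul_zero, zero_add]
    exact (Nat.floor_le (Real.sqrt_nonneg _)).trans (by linarith)
  · rw [polyBatch_sqrt hb.ne']
    exact (Nat.ceil_lt_add_one (Real.sqrt_nonneg _)).le

/-- Only the second half of the `2 l` batches is counted; each of these has length at least `√(ν l /
N)`. -/
theorem le_sum_polyBatch_sqrt (hν : 0 < ν) (hz : 0 < z) {l : ℕ} (hl : 0 < l) :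
    l * √(ν * l / N) ≤
      ((∑ i ∈ Finset.range (2 * l), polyBatch (1 / (N : ℝ) ^ (1 / 2 : ℝ)) z (1 / 2) ν i : ℕ) : ℝ) := by
  push_cast
  rw [two_mul, Finset.sum_range_add]
  have h1 : ∀ i ∈ Finset.range l, √(ν * l / N) ≤
      (polyBatch (1 / (N : ℝ) ^ (1 / 2 : ℝ)) z (1 / 2) ν (l + i) : ℝ) := by
    intro i _
    rw [polyBatch_sqrt (by omega)]
    refine le_trans ?_ (Nat.le_ceil _)
    gcongr
    have : ν * (l : ℝ) ≤ ν * ((l + i : ℕ) : ℝ) := by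
      gcongr
      omega
    linarith
  have h2 := Finset.card_nsmul_le_sum _ _ _ h1
  rw [Finset.card_range, nsmul_eq_mul] at h2
  have h3 : (0 : ℝ) ≤ ∑ i ∈ Finset.range l,
    (polyBatch (1 / (N : ℝ) ^ (1 / 2 : ℝ)) z (1 / 2) ν i : ℝ) := by positivity
  linarith

end Batches

/-! ### The assumptions in terms of one constant -/

section Constants

variable {n m g N : ℕ} {S : Problem n m g N} {Lctrl ctrl0max : ℝ}

theorem Problem.PoolAssumption.norm_ctrl_sub_le (hpool : S.PoolAssumption Lctrl ctrl0max)
    (k : Fin N) (x y : Vec n) : ‖S.ctrl k x - S.ctrl k y‖ ≤ |Lctrl| * ‖x - y‖ :=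
  (hpool.2 k x y).trans (mul_le_mul_of_nonneg_right (le_abs_self Lctrl) (norm_nonneg _))

theorem Problem.PoolAssumption.norm_ctrl_le (hpool : S.PoolAssumption Lctrl ctrl0max)
    (k : Fin N) (x : Vec n) : ‖S.ctrl k x‖ ≤ |Lctrl| * ‖x‖ + ctrl0max := by
  have h1 := hpool.norm_ctrl_sub_le k x 0
  rw [sub_zero] at h1
  linarith [norm_sub_norm_le (S.ctrl k x) (S.ctrl k 0), hpool.1 k]

theorem Problem.PoolAssumption.norm_add_norm_ctrl_le (hpool : S.PoolAssumption Lctrl ctrl0max)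
    (h0 : 0 ≤ ctrl0max) (k : Fin N) (x : Vec n) :
    ‖x‖ + ‖S.ctrl k x‖ ≤ (1 + |Lctrl| + ctrl0max) * (1 + ‖x‖) := by
  have h1 := hpool.norm_ctrl_le k x
  have h2 := mul_nonneg h0 (norm_nonneg x)
  have h3 := abs_nonneg Lctrl
  linarith

theorem Problem.CostAssumption.cost_le {Lc1 Lc2 c0max : ℝ}
    (hcost : S.CostAssumption Lc1 Lc2 c0max) (hLc1 : 0 < Lc1) (hLc2 : 0 < Lc2)
    (hc0max : 0 ≤ c0max) {M : ℝ} (hM : 0 ≤ M) {k : Fin N} {x : Vec n}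
    (hx : ‖x‖ + ‖S.ctrl k x‖ ≤ M * (1 + ‖x‖)) (t : ℕ) :
    S.cost t x (S.ctrl k x) ≤
      (c0max + 2 * Lc1 * M ^ 2 + 2 * Lc2 * M) * (1 + ‖x‖ ^ 2) := by
  have h1 := le_of_abs_le (hcost.2.1 t x 0 (S.ctrl k x) 0)
  simp only [norm_zero, sub_zero, max_eq_left (norm_nonneg _)] at h1
  have h3 := le_of_abs_le (hcost.2.2 t)
  have h5 : (Lc1 * (‖x‖ + ‖S.ctrl k x‖) + Lc2) * (‖x‖ + ‖S.ctrl k x‖) ≤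
      (Lc1 * (M * (1 + ‖x‖)) + Lc2) * (M * (1 + ‖x‖)) := by gcongr
  have h6 : (1 + ‖x‖) ^ 2 ≤ 2 * (1 + ‖x‖ ^ 2) := by nlinarith [sq_nonneg (‖x‖ - 1)]
  have h7 : 1 + ‖x‖ ≤ 2 * (1 + ‖x‖ ^ 2) := by nlinarith [sq_nonneg (‖x‖ - 1)]
  have h8 := mul_le_mul_of_nonneg_left h6 (show 0 ≤ Lc1 * M ^ 2 by positivity)
  have h9 := mul_le_mul_of_nonneg_left h7 (show 0 ≤ Lc2 * M by positivity)
  have h10 := mul_nonneg hc0max (sq_nonneg ‖x‖)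
  linarith

theorem Problem.CostAssumption.cost_sub_le {Lc1 Lc2 c0max : ℝ}
    (hcost : S.CostAssumption Lc1 Lc2 c0max) (hLc1 : 0 < Lc1) (hLc2 : 0 < Lc2)
    (hpool : S.PoolAssumption Lctrl ctrl0max) (h0 : 0 ≤ ctrl0max) (t : ℕ) (k : Fin N)
    (x y : Vec n) :
    S.cost t x (S.ctrl k x) - S.cost t y (S.ctrl k y) ≤
      (Lc1 * (1 + |Lctrl| + ctrl0max) + Lc2) * (1 + |Lctrl| + ctrl0max) *
        (1 + ‖x‖ + ‖y‖) * ‖x - y‖ := by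
  set M := 1 + |Lctrl| + ctrl0max with hM
  have hl := abs_nonneg Lctrl
  have hx := norm_nonneg x
  have hy := norm_nonneg y
  have h1 := le_of_abs_le (hcost.2.1 t x y (S.ctrl k x) (S.ctrl k y))
  have h2 : max ‖x‖ ‖y‖ ≤ ‖x‖ + ‖y‖ := max_le (by linarith) (by linarith)
  have h3 : max ‖S.ctrl k x‖ ‖S.ctrl k y‖ ≤ |Lctrl| * (‖x‖ + ‖y‖) + ctrl0max := by
    have := mul_nonneg hl hx
    have := mul_nonneg hl hy
    refine max_le ((hpool.norm_ctrl_le k x).trans ?_) ((hpool.norm_ctrl_le k y).trans ?_) <;>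
      linarith
  have h4 : max ‖x‖ ‖y‖ + max ‖S.ctrl k x‖ ‖S.ctrl k y‖ ≤ M * (1 + ‖x‖ + ‖y‖) := by
    have h5 := mul_nonneg h0 (add_nonneg hx hy)
    rw [hM]
    linarith
  have h5 : ‖x - y‖ + ‖S.ctrl k x - S.ctrl k y‖ ≤ M * ‖x - y‖ := by
    have h6 := hpool.norm_ctrl_sub_le k x y
    have h7 := mul_nonneg h0 (norm_nonneg (x - y))
    rw [hM]
    linarith
  have h6 : Lc2 ≤ Lc2 * (1 + ‖x‖ + ‖y‖) := le_mul_of_one_le_right hLc2.le (by linarith)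
  have h7 : 0 ≤ M := by positivity
  calc _ ≤ _ := h1
    _ ≤ (Lc1 * (M * (1 + ‖x‖ + ‖y‖)) + Lc2 * (1 + ‖x‖ + ‖y‖)) * (M * ‖x - y‖) := by
      refine mul_le_mul ?_ h5 (by positivity) (by positivity)
      exact add_le_add (mul_le_mul_of_nonneg_left h4 hLc1.le) h6
    _ = _ := by ring

theorem Problem.DynamicsAssumption.norm_le {Lf f0 : ℝ} (hdyn : S.DynamicsAssumption Lf f0)
    (hLf : 0 ≤ Lf) {M : ℝ} {k : Fin N} {x : Vec n}
    (hx : ‖x‖ + ‖S.ctrl k x‖ ≤ M * (1 + ‖x‖)) {w : Vec g} (hw : ‖w‖ ≤ S.wmax) :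
    ‖S.f x (S.ctrl k x) w‖ ≤ (|f0| + Lf * (M + S.wmax)) * (1 + ‖x‖) := by
  have hw0 : 0 ≤ S.wmax := (norm_nonneg w).trans hw
  have h1 := hdyn.1 x 0 (S.ctrl k x) 0 w 0 hw (by rwa [norm_zero])
  simp only [sub_zero] at h1
  have h2 := norm_sub_norm_le (S.f x (S.ctrl k x) w) (S.f 0 0 0)
  have h3 := hdyn.2.trans (le_abs_self f0)
  have h4 : ‖x‖ + ‖S.ctrl k x‖ + ‖w‖ ≤ (M + S.wmax) * (1 + ‖x‖) := by
    have := mul_nonneg hw0 (norm_nonneg x)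
    linarith
  have h5 := mul_le_mul_of_nonneg_left h4 hLf
  have h6 := mul_nonneg (abs_nonneg f0) (norm_nonneg x)
  linarith

/-- A common constant for the assumptions on dynamics, costs and controllers. -/
noncomputable def tameConst (Lf f0 Lc1 Lc2 c0max M wmax γ r0 δ : ℝ) : ℝ :=
  1 + (c0max + 2 * Lc1 * M ^ 2 + 2 * Lc2 * M) + (Lc1 * M + Lc2) * M +
    (|f0| + Lf * (M + wmax)) + γ * wmax + |δ| + r0 + 1 / r0

/-- Since `τ 1 ≥ τ 0`, the hypothesis gives `β (τ 0)² < 1 / (2√2) ≤ (3/5)²`. -/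
theorem factor_le_of_ratio {β : ℕ → ℝ} (hβ : IsDecayRate β) {τ : ℕ → ℕ} (hmono : Monotone τ)
    (hτ0 : 0 < τ 0) (hratio : (τ 1 : ℝ) / τ 0 * β (τ 0) ^ 2 < 1 / (2 * √2)) :
    β (τ 0) ≤ 3 / 5 := by
  have h0 : (0 : ℝ) < τ 0 := by exact_mod_cast hτ0
  have h1 : (1 : ℝ) ≤ (τ 1 : ℝ) / τ 0 := by
    rw [one_le_div h0]
    exact_mod_cast hmono zero_le_one
  have h2 : 1 / (2 * √2) ≤ (9 : ℝ) / 25 := by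
    rw [div_le_div_iff₀ (by positivity) (by norm_num)]
    have : (25 / 18 : ℝ) ≤ √2 := Real.le_sqrt_of_sq_le (by norm_num)
    linarith
  have h3 := hβ.nonneg (τ 0)
  have h4 := mul_le_mul_of_nonneg_right h1 (sq_nonneg (β (τ 0)))
  nlinarith

theorem tame_of_assumptions {Lf f0 Lc1 Lc2 c0max wmax γ r0 α0 δ : ℝ} {β : ℕ → ℝ}
    (hLf : 1 ≤ Lf) (hLc1 : 0 < Lc1) (hLc2 : 0 < Lc2) (hc0max : 0 ≤ c0max)
    (hctrl0max : 0 ≤ ctrl0max) (hwmax : 0 < wmax) (hγ : 0 < γ) (hr0 : 0 < r0)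
    (hβ : IsDecayRate β) (hα0 : β 0 < α0) {A : Input N}
    {istar : Fin N} (hSw : S.wmax = wmax) (hS0 : ‖S.x0‖ = r0) (hnoise : S.BoundedNoise)
    (hdyn : S.DynamicsAssumption Lf f0) (hcost : S.CostAssumption Lc1 Lc2 c0max)
    (hpool : S.PoolAssumption Lctrl ctrl0max) (hstar : istar ∈ S.stabilizing β γ)
    (hAβ : A.β = β) (hAγ : A.γ = γ) (hAα : A.α0 = α0) (hAδ : A.δ = δ)
    (hpick : A.ValidPick ‖S.x0‖) (hy : A.y = 1 / 2) (hmono : Monotone A.τ) (hτ0 : 0 < A.τ 0)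
    (hratio : (A.τ 1 : ℝ) / A.τ 0 * β (A.τ 0) ^ 2 < 1 / (2 * √2))
    (hδ : γ * wmax / (1 - β (A.τ 0)) ≤ δ) (hη : 0 < A.η0) :
    Tame S A istar (tameConst Lf f0 Lc1 Lc2 c0max (1 + |Lctrl| + ctrl0max) wmax γ r0 δ)
      (β (A.τ 0)) := by
  set M := 1 + |Lctrl| + ctrl0max with hM
  have hl := abs_nonneg Lctrl
  have hM0 : 0 ≤ M := by positivity
  have hδ' := abs_nonneg δ
  have hγw : 0 < γ * wmax := mul_pos hγ hwmax
  have hr0' : 0 < 1 / r0 := by positivity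
  have t1 : 0 ≤ c0max + 2 * Lc1 * M ^ 2 + 2 * Lc2 * M := by positivity
  have t2 : 0 ≤ (Lc1 * M + Lc2) * M := by positivity
  have t3 : 0 ≤ |f0| + Lf * (M + wmax) := by positivity
  have hq := factor_le_of_ratio hβ hmono hτ0 hratio
  -- `G` is an opaque name for a sum of nonnegative summands, among which `linarith` finds each
  -- required constant.
  obtain ⟨G, hG⟩ : ∃ G, G = tameConst Lf f0 Lc1 Lc2 c0max M wmax γ r0 δ := ⟨_, rfl⟩
  have hG' := hG
  rw [tameConst] at hG'
  rw [← hG]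
  exact
    { one_le := by linarith
      decay := hAβ ▸ hβ
      noise := hnoise
      cost_nonneg := hcost.1
      cost_le := fun t k x =>
        (hcost.cost_le hLc1 hLc2 hc0max hM0 (hpool.norm_add_norm_ctrl_le hctrl0max k x) t).trans
          (mul_le_mul_of_nonneg_right (by linarith) (by positivity))
      cost_sub_le := fun t k x y =>
        (hcost.cost_sub_le hLc1 hLc2 hpool hctrl0max t k x y).trans
          (mul_le_mul_of_nonneg_right
            (mul_le_mul_of_nonneg_right (by linarith) (by positivity)) (norm_nonneg _))
      growth := fun k x w hw =>
        (hdyn.norm_le (by linarith) (hpool.norm_add_norm_ctrl_le hctrl0max k x) hw).trans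
          (mul_le_mul_of_nonneg_right (by rw [hSw]; linarith) (by positivity))
      gain_nonneg := by rw [hAγ, hSw]; exact hγw.le
      gain_le := by rw [hAγ, hSw]; linarith
      gain_le_offset := by
        rw [hAγ, hSw, hAδ]
        rwa [div_le_iff₀ (by linarith), mul_comm δ] at hδ
      offset_le := by rw [hAδ]; linarith [le_abs_self δ]
      start_le := by rw [hS0]; linarith
      le_start := by
        rw [hS0]
        exact (div_le_iff₀ hr0).1 (by linarith)
      factor_nonneg := hβ.nonneg _
      factor_le := hq
      decay_le := fun b => hAβ ▸ hβ.1 (hmono (Nat.zero_le b))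
      scale := by rw [hAα, ← hβ.2.1]; exact hα0
      pick := hpick
      batch_pos := fun b => hτ0.trans_le (hmono (Nat.zero_le b))
      batch_mono := hmono
      star := by rw [hAβ, hAγ]; exact hstar
      rate_pos := hη
      exponent := hy }

end Constants

/-! ### The regret bound in terms of the horizon -/

section Horizon

variable {n m g N : ℕ} {S : Problem n m g N} {A : Input N} {istar : Fin N} {G q : ℝ}
  {Ω : Type*} [MeasurableSpace Ω] {P : Measure Ω} [IsProbabilityMeasure P] {K : ℕ → Ω → Fin N}

/-- Ratio of the number of batches to `T^{2/3} N^{1/3}`. -/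
noncomputable def batchConst (ν : ℝ) : ℝ := 2 * (1 / ν) ^ (1 / 3 : ℝ) + 3

/-- Ratio of the longest batch length to `T^{1/3} N^{-1/3}`. -/
noncomputable def lengthConst (ν ζ : ℝ) : ℝ := √(ν * batchConst ν + |ζ|) + 1

/-- The choice is `B = U + 2 l` with `l` just above `ν^{-1/3} D`: `l √(ν l / N) > T` amounts to `ν
l³ > T² N`, and `U ≤ N ≤ D` keeps `B` of order `D`. -/
theorem exists_batch_number {T U : ℕ} {z ζ ν : ℝ} (hν : 0 < ν) (hz : 0 < z) (hzζ : z ≤ ζ * N)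
    (hN : 1 ≤ N) (hNT : N ≤ T) (hU : U ≤ N) :
    ∃ B : ℕ, 1 ≤ B ∧
      T < ∑ i ∈ Finset.range (B - U), polyBatch (1 / (N : ℝ) ^ (1 / 2 : ℝ)) z (1 / 2) ν i ∧
      (B : ℝ) ≤ batchConst ν * (((T : ℝ) ^ (1 / 3 : ℝ)) ^ 2 * (N : ℝ) ^ (1 / 3 : ℝ)) ∧
      (polyBatch (1 / (N : ℝ) ^ (1 / 2 : ℝ)) z (1 / 2) ν B : ℝ) ≤
        lengthConst ν ζ * ((T : ℝ) ^ (1 / 3 : ℝ) / (N : ℝ) ^ (1 / 3 : ℝ)) := by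
  have hcube : ∀ x : ℝ, 0 ≤ x → (x ^ (1 / 3 : ℝ)) ^ 3 = x := fun x hx => by
    rw [← Real.rpow_natCast, ← Real.rpow_mul hx]
    norm_num
  have hN' : (1 : ℝ) ≤ N := by exact_mod_cast hN
  have hNT' : (N : ℝ) ≤ T := by exact_mod_cast hNT
  have hU' : (U : ℝ) ≤ N := by exact_mod_cast hU
  set a := (T : ℝ) ^ (1 / 3 : ℝ) with ha
  set c := (N : ℝ) ^ (1 / 3 : ℝ) with hc
  have ha3 : a ^ 3 = T := hcube _ (by linarith)
  have hc3 : c ^ 3 = N := hcube _ (by linarith)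
  have hc1 : 1 ≤ c := Real.one_le_rpow hN' (by norm_num)
  have hca : c ≤ a := Real.rpow_le_rpow (by linarith) hNT' (by norm_num)
  set ρ := (1 / ν) ^ (1 / 3 : ℝ) with hρ
  have hρ3 : ρ ^ 3 = 1 / ν := hcube _ (by positivity)
  have hρ0 : 0 < ρ := Real.rpow_pos_of_pos (by positivity) _
  set D := a ^ 2 * c with hD
  have hDN : (N : ℝ) ≤ D := by
    rw [← hc3, hD]
    nlinarith [mul_le_mul hca hca (by linarith) (by linarith)]
  have hD0 : 0 < D := by linarith
  set l := ⌊D * ρ⌋₊ + 1 with hl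
  have hl1 : D * ρ < l := by
    rw [hl]; push_cast; exact Nat.lt_floor_add_one _
  have hl2 : (l : ℝ) ≤ D * ρ + 1 := by
    rw [hl]; push_cast
    linarith [Nat.floor_le (show 0 ≤ D * ρ by positivity)]
  -- In `batchConst`, `2 ρ` comes from `2 l`; the 3 pays for `U ≤ D` and for the rounding of `l`, at
  -- most `2 ≤ 2 D`.
  have hB : ((U + 2 * l : ℕ) : ℝ) ≤ batchConst ν * D := by
    rw [batchConst, ← hρ]
    push_cast
    nlinarith
  refine ⟨U + 2 * l, by omega, ?_, hB, ?_⟩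
  · rw [Nat.add_sub_cancel_left]
    have h1 := le_sum_polyBatch_sqrt (N := N) hν hz (l := l) (by omega)
    suffices (T : ℝ) < l * √(ν * l / N) by exact_mod_cast this.trans_le h1
    have hl0 : (0 : ℝ) < l := lt_trans (by positivity) hl1
    refine lt_of_pow_lt_pow_left₀ 2 (by positivity) ?_
    rw [mul_pow, Real.sq_sqrt (by positivity)]
    have h2 : (D * ρ) ^ 3 < (l : ℝ) ^ 3 := by gcongr
    have h3 : (D * ρ) ^ 3 = (T : ℝ) ^ 2 * N / ν := by
      rw [mul_pow, hρ3, hD, mul_pow, ← pow_mul, mul_comm 2 3, pow_mul, ha3, hc3]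
      ring
    rw [h3, div_lt_iff₀ hν] at h2
    calc (T : ℝ) ^ 2 = (T : ℝ) ^ 2 * N / N := by field_simp
      _ < (l : ℝ) ^ 3 * ν / N := by gcongr
      _ = _ := by ring
  · refine (polyBatch_sqrt_le _).trans ?_
    have hθ : 1 ≤ a / c := by rw [one_le_div (by linarith)]; exact hca
    have h1 : (ν * ((U + 2 * l : ℕ) : ℝ) + z) / N ≤ (ν * batchConst ν + |ζ|) * (a / c) ^ 2 := by
      have h2 : D / N = (a / c) ^ 2 := by
        rw [← hc3, hD]; field_simp
      have h3 : z / N ≤ |ζ| := by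
        rw [div_le_iff₀ (by linarith)]
        exact hzζ.trans (by gcongr; exact le_abs_self ζ)
      have h4 : |ζ| ≤ |ζ| * (a / c) ^ 2 := le_mul_of_one_le_right (abs_nonneg _) (one_le_pow₀ hθ)
      have h5 : ν * ((U + 2 * l : ℕ) : ℝ) / N ≤ ν * (batchConst ν * D) / N := by gcongr
      have h6 : ν * (batchConst ν * D) / N = ν * batchConst ν * (D / N) := by ring
      rw [add_div]
      rw [h6, h2] at h5
      linarith
    have h2 := Real.sqrt_le_sqrt h1
    rw [Real.sqrt_mul (by unfold batchConst; positivity), Real.sqrt_sq (by positivity)] at h2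
    rw [lengthConst]
    linarith

/-- A common constant for the terms of the regret bound. -/
noncomputable def regretConst (G ν ζ ηlo ηhi : ℝ) : ℝ :=
  2 / ηlo + 40 * G ^ 4 * lengthConst ν ζ +
    (9 * G ^ 6 * |ηhi| * lengthConst ν ζ ^ 2 + 32 * G ^ 3 * (1 + lengthConst ν ζ)) *
      (batchConst ν * (1 + 5 * G ^ 4) + 5 / 2)

theorem one_le_lengthConst (ν ζ : ℝ) : 1 ≤ lengthConst ν ζ := by
  unfold lengthConst
  linarith [Real.sqrt_nonneg (ν * batchConst ν + |ζ|)]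

/-- The terms of the regret bound, for `B ≤ b D` batches of length at most `τ ≤ L a`. -/
theorem regret_terms_le {G L b u X a D τ η h h' lN lT M B ηlo ηhi : ℝ} (hG : 1 ≤ G)
    (hL : 0 ≤ L) (hb : 0 ≤ b) (hu : 1 ≤ u) (hX : 1 ≤ X) (ha : 1 ≤ a) (hD : 1 ≤ D)
    (hη : 0 < η) (hh : 0 ≤ h) (hhτ : h ≤ τ) (hh' : h ≤ h') (hlN : 0 ≤ lN)
    (hlT : lN ≤ lT) (hηlo : 0 < ηlo) (hηlo' : ηlo ≤ η * D)
    (hηhi : η * D ≤ |ηhi|) (hB0 : 0 ≤ B) (hB : B ≤ b * D) (hτa : τ ≤ L * a)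
    (hMτ : M * τ ^ 2 ≤ L ^ 2 * D) :
    2 * (lN / η) * u + 40 * G ^ 4 * τ * X ^ 4 +
      (9 * G ^ 6 * (η * u) * M * τ ^ 2 + 32 * G ^ 3 * h) *
        (B * (1 + 5 * G ^ 4) + 5 / 2 * X ^ 5) ≤
    (2 / ηlo + 40 * G ^ 4 * L + (9 * G ^ 6 * |ηhi| * L ^ 2 + 32 * G ^ 3 * (1 + L)) *
      (b * (1 + 5 * G ^ 4) + 5 / 2)) * ((1 + lT) * D * u + X ^ 5 * a * u + D * h') := by
  have hlT0 : 0 ≤ lT := hlN.trans hlT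
  have e1 : 2 * (lN / η) * u ≤ 2 / ηlo * ((1 + lT) * D * u) := by
    have : lN / η ≤ (1 + lT) * D / ηlo := by
      rw [div_le_div_iff₀ hη hηlo]
      calc lN * ηlo ≤ (1 + lT) * (η * D) := by
            gcongr
            linarith
        _ = _ := by ring
    calc _ ≤ 2 * ((1 + lT) * D / ηlo) * u := by gcongr
      _ = _ := by ring
  have e2 : 40 * G ^ 4 * τ * X ^ 4 ≤ 40 * G ^ 4 * L * (X ^ 5 * a * u) := by
    have h4 : X ^ 4 ≤ X ^ 5 := pow_le_pow_right₀ hX (by norm_num)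
    calc _ ≤ 40 * G ^ 4 * (L * a) * X ^ 5 := by gcongr
      _ ≤ 40 * G ^ 4 * (L * a) * X ^ 5 * u := le_mul_of_one_le_right (by positivity) hu
      _ = _ := by ring
  obtain ⟨s, hs⟩ : ∃ s, s = B * (1 + 5 * G ^ 4) + 5 / 2 * X ^ 5 := ⟨_, rfl⟩
  obtain ⟨k, hk⟩ : ∃ k, k = b * (1 + 5 * G ^ 4) + 5 / 2 := ⟨_, rfl⟩
  rw [← hs, ← hk]
  have hk0 : 0 ≤ k := by rw [hk]; positivity
  have hs0 : 0 ≤ s := by rw [hs]; positivity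
  have hs1 : s ≤ k * (D + X ^ 5) := by
    have h4 : B * (1 + 5 * G ^ 4) ≤ b * D * (1 + 5 * G ^ 4) := by gcongr
    have h5 : 0 ≤ b * (1 + 5 * G ^ 4) * X ^ 5 := by positivity
    rw [hs, hk]
    linarith
  have e3 : 9 * G ^ 6 * (η * u) * M * τ ^ 2 * s ≤
      9 * G ^ 6 * |ηhi| * L ^ 2 * k * ((1 + lT) * D * u + X ^ 5 * a * u) := by
    have h4 : D + X ^ 5 ≤ (1 + lT) * D + X ^ 5 * a := by
      have : 0 ≤ lT * D := by positivity
      have : X ^ 5 ≤ X ^ 5 * a := le_mul_of_one_le_right (by positivity) ha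
      linarith
    calc _ = 9 * G ^ 6 * η * (M * τ ^ 2) * u * s := by ring
      _ ≤ 9 * G ^ 6 * η * (L ^ 2 * D) * u * (k * (D + X ^ 5)) := by gcongr
      _ = 9 * G ^ 6 * (η * D) * L ^ 2 * k * u * (D + X ^ 5) := by ring
      _ ≤ 9 * G ^ 6 * |ηhi| * L ^ 2 * k * u * ((1 + lT) * D + X ^ 5 * a) := by gcongr
      _ = _ := by ring
  have e4 : 32 * G ^ 3 * h * s ≤
      32 * G ^ 3 * k * (D * h') + 32 * G ^ 3 * L * k * (X ^ 5 * a * u) := by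
    have h4 : h * X ^ 5 ≤ L * (X ^ 5 * a * u) := by
      calc h * X ^ 5 ≤ L * a * X ^ 5 := by gcongr; exact hhτ.trans hτa
        _ ≤ L * a * X ^ 5 * u := le_mul_of_one_le_right (by positivity) hu
        _ = _ := by ring
    have h5 : h * D ≤ h' * D := by gcongr
    calc _ ≤ 32 * G ^ 3 * h * (k * (D + X ^ 5)) := by gcongr
      _ = 32 * G ^ 3 * k * (h * D + h * X ^ 5) := by ring
      _ ≤ 32 * G ^ 3 * k * (h' * D + L * (X ^ 5 * a * u)) := by gcongr
      _ = _ := by ring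
  have p1 : 0 ≤ (1 + lT) * D * u := by positivity
  have p2 : 0 ≤ X ^ 5 * a * u := by positivity
  have p3 : 0 ≤ D * h' := mul_nonneg (by linarith) (hh.trans hh')
  have q1 : 0 ≤ 2 / ηlo := by positivity
  have q2 : 0 ≤ 40 * G ^ 4 * L := by positivity
  have q3 : 0 ≤ 9 * G ^ 6 * |ηhi| * L ^ 2 * k := by positivity
  have q4 : 0 ≤ 32 * G ^ 3 * k := by positivity
  have q5 : 0 ≤ 32 * G ^ 3 * L * k := by positivity
  -- With the three target quantities as atoms, the claim is linear up to nonnegative cross terms,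
  -- collected in `m1`.
  generalize (1 + lT) * D * u = Y1 at *
  generalize X ^ 5 * a * u = Y2 at *
  generalize D * h' = Y3 at *
  have m1 : 0 ≤ 2 / ηlo * (Y2 + Y3) + 40 * G ^ 4 * L * (Y1 + Y3) +
      9 * G ^ 6 * |ηhi| * L ^ 2 * k * Y3 + 32 * G ^ 3 * k * (Y1 + Y2) +
      32 * G ^ 3 * L * k * (Y1 + Y3) := by positivity
  linarith

theorem Tame.regret_le_horizon (hT : Tame S A istar G q) (hK : IsSampled S A P K) {T U : ℕ}
    {z ζ ν ηlo ηhi : ℝ} (hU : U = (S.destabilizing A.β A.γ).ncard)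
    (hν : 0 < ν) (hz : 0 < z) (hzζ : z ≤ ζ * N) (hηlo : 0 < ηlo)
    (hτ : A.τ = polyBatch (1 / (N : ℝ) ^ (1 / 2 : ℝ)) z (1 / 2) ν) (hNT : N ≤ T)
    (h1 : ηlo / (((T : ℝ) ^ (1 / 3 : ℝ)) ^ 2 * (N : ℝ) ^ (1 / 3 : ℝ)) ≤ A.η0)
    (h2 : A.η0 ≤ ηhi / (((T : ℝ) ^ (1 / 3 : ℝ)) ^ 2 * (N : ℝ) ^ (1 / 3 : ℝ))) :
    regret S A P K T istar ≤ regretConst G ν ζ ηlo ηhi *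
      ((1 + Real.log T) * (((T : ℝ) ^ (1 / 3 : ℝ)) ^ 2 * (N : ℝ) ^ (1 / 3 : ℝ)) *
          ((U : ℝ) + 1) ^ (1 / 2 : ℝ) +
        stateBound G U ^ 5 * (T : ℝ) ^ (1 / 3 : ℝ) * ((U : ℝ) + 1) ^ (1 / 2 : ℝ) +
        ((T : ℝ) ^ (1 / 3 : ℝ)) ^ 2 * (N : ℝ) ^ (1 / 3 : ℝ) * decaySum A.β
          ⌊lengthConst ν ζ * ((T : ℝ) ^ (1 / 3 : ℝ) / (N : ℝ) ^ (1 / 3 : ℝ))⌋₊) := by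
  have hG := hT.one_le
  have hN : 1 ≤ N := istar.pos
  have hUN : U ≤ N := by
    rw [hU]
    refine (Set.ncard_le_card _).trans_eq ?_
    simp
  obtain ⟨B, hB1, hBT, hBD, hBτ⟩ := exists_batch_number hν hz hzζ hN hNT hUN
  rw [← hτ] at hBT hBτ
  refine (hT.regret_le_batches hK hU hB1 hBT).trans ?_
  have hN' : (1 : ℝ) ≤ N := by exact_mod_cast hN
  have hNT' : (N : ℝ) ≤ T := by exact_mod_cast hNT
  have hc3 : ((N : ℝ) ^ (1 / 3 : ℝ)) ^ 3 = N := by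
    rw [← Real.rpow_natCast, ← Real.rpow_mul (by linarith)]
    norm_num
  have hc1 : 1 ≤ (N : ℝ) ^ (1 / 3 : ℝ) := Real.one_le_rpow hN' (by norm_num)
  have hca : (N : ℝ) ^ (1 / 3 : ℝ) ≤ (T : ℝ) ^ (1 / 3 : ℝ) :=
    Real.rpow_le_rpow (by linarith) hNT' (by norm_num)
  have hL := one_le_lengthConst ν ζ
  have hdτ : decaySum A.β (A.τ B) ≤ A.τ B := by
    refine (Finset.sum_le_card_nsmul _ _ 1 fun i _ => hT.decay.le_one i).trans_eq ?_
    simp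
  have hd := decaySum_mono hT.decay (Nat.le_floor hBτ)
  have ha1 := hc1.trans hca
  have hD1 := one_le_mul_of_one_le_of_one_le (one_le_pow₀ ha1 (n := 2)) hc1
  rw [div_le_iff₀ (by linarith)] at h1
  rw [le_div_iff₀ (by linarith)] at h2
  refine regret_terms_le hG (by linarith) (by unfold batchConst; positivity)
    (Real.one_le_rpow (by linarith [(Nat.cast_nonneg U : (0 : ℝ) ≤ U)]) (by norm_num))
    (by linarith [(le_stateBound hG U).1]) ha1 hD1 hT.rate_pos
    (decaySum_nonneg hT.decay _) hdτ hd (Real.log_natCast_nonneg N)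
    (Real.log_le_log (by linarith) hNT') hηlo h1
    (h2.trans (le_abs_self _)) (Nat.cast_nonneg B) hBD (hBτ.trans ?_) ?_
  · gcongr
    exact div_le_self (by linarith) hc1
  · generalize (T : ℝ) ^ (1 / 3 : ℝ) = a at *
    generalize (N : ℝ) ^ (1 / 3 : ℝ) = c at *
    calc (N : ℝ) * (A.τ B : ℝ) ^ 2 ≤ N * (lengthConst ν ζ * (a / c)) ^ 2 := by gcongr
      _ = lengthConst ν ζ ^ 2 * (a ^ 2 * c) := by rw [← hc3]; field_simp

end Horizon

/-! ### Asymptotics -/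

section Asymptotics

theorem one_le_tameConst {Lf f0 Lc1 Lc2 c0max M wmax γ r0 δ : ℝ} (hLf : 0 ≤ Lf) (hLc1 : 0 ≤ Lc1)
    (hLc2 : 0 ≤ Lc2) (hc0max : 0 ≤ c0max) (hM : 0 ≤ M) (hwmax : 0 ≤ wmax) (hγ : 0 ≤ γ)
    (hr0 : 0 ≤ r0) : 1 ≤ tameConst Lf f0 Lc1 Lc2 c0max M wmax γ r0 δ := by
  have : 0 ≤ (c0max + 2 * Lc1 * M ^ 2 + 2 * Lc2 * M) + (Lc1 * M + Lc2) * M +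
    (|f0| + Lf * (M + wmax)) + γ * wmax + |δ| + r0 + 1 / r0 := by positivity
  unfold tameConst
  linarith

theorem regretConst_nonneg {G ν ζ ηlo ηhi : ℝ} (hG : 1 ≤ G) (hν : 0 < ν) (hηlo : 0 < ηlo) :
    0 ≤ regretConst G ν ζ ηlo ηhi := by
  have := one_le_lengthConst ν ζ
  unfold regretConst batchConst
  positivity

theorem stateBound_pow_five {G : ℝ} (hG : 1 ≤ G) (U : ℕ) :
    stateBound G U ^ 5 = (2 * G) ^ 5 * Real.exp (5 * Real.log (3 * G ^ 2) * U) := by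
  have h : 0 < 3 * G ^ 2 := by positivity
  have h1 : Real.exp (5 * Real.log (3 * G ^ 2) * U) = (3 * G ^ 2) ^ (U * 5) := by
    generalize 3 * G ^ 2 = y at *
    rw [← Real.rpow_natCast, Real.rpow_def_of_pos h]
    congr 1
    push_cast
    ring
  rw [stateBound, mul_pow, ← pow_mul, h1]

theorem decaySum_le_log {β : ℕ → ℝ} {CH L x y : ℝ}
    (hH : ∀ t, 1 ≤ t → decaySum β t ≤ CH * ∑ i ∈ Finset.Icc 1 t, (1 / (i : ℝ)))
    (hL : 1 ≤ L) (hx : 1 ≤ x) (hxy : x ≤ y) :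
    decaySum β ⌊L * x⌋₊ ≤ |CH| * (1 + Real.log L) * (1 + Real.log y) := by
  have h1 : 1 ≤ L * x := one_le_mul_of_one_le_of_one_le hL hx
  have h2 : 1 ≤ ⌊L * x⌋₊ := Nat.le_floor (by simpa using h1)
  have h3 := harmonic_le_one_add_log ⌊L * x⌋₊
  rw [harmonic_eq_sum_Icc] at h3
  push_cast at h3
  simp only [← one_div] at h3
  have h4 : Real.log (⌊L * x⌋₊ : ℝ) ≤ Real.log L + Real.log y := by
    rw [← Real.log_mul (by linarith) (by linarith)]
    refine Real.log_le_log (by exact_mod_cast h2) ((Nat.floor_le (by linarith)).trans ?_)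
    gcongr
  have hlL := Real.log_nonneg hL
  have hly := Real.log_nonneg (hx.trans hxy)
  calc _ ≤ CH * ∑ i ∈ Finset.Icc 1 ⌊L * x⌋₊, (1 / (i : ℝ)) := hH _ h2
    _ ≤ |CH| * ∑ i ∈ Finset.Icc 1 ⌊L * x⌋₊, (1 / (i : ℝ)) := by
        gcongr
        exact le_abs_self CH
    _ ≤ |CH| * ((1 + Real.log L) * (1 + Real.log y)) := by
        gcongr
        have := mul_nonneg hlL hly
        linarith
    _ = _ := by ring

/-- The error terms of the regret bound for general decay rates. -/
noncomputable def errorTerm (β : ℕ → ℝ) (L R R' : ℝ) (N T : ℕ) : ℝ :=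
  R' / (T : ℝ) ^ (1 / 3 : ℝ) + R * (decaySum β
    ⌊L * ((T : ℝ) ^ (1 / 3 : ℝ) / (N : ℝ) ^ (1 / 3 : ℝ))⌋₊ /
      ((T : ℝ) ^ (1 / 3 : ℝ) / (N : ℝ) ^ (1 / 3 : ℝ)))

/-- `H(t) / t` is the Cesàro mean of `β`, hence tends to 0; replacing `θ = (T/N)^{1/3}` by `⌊L θ⌋`
costs a factor `L`. -/
theorem tendsto_errorTerm {β : ℕ → ℝ} (hβ : IsDecayRate β) {L : ℝ} (hL : 1 ≤ L) (R R' : ℝ)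
    (N : ℕ) : Tendsto (errorTerm β L R R' N) atTop (𝓝 0) := by
  have hT : Tendsto (fun T : ℕ => (T : ℝ) ^ (1 / 3 : ℝ)) atTop atTop :=
    (tendsto_rpow_atTop (by norm_num)).comp tendsto_natCast_atTop_atTop
  have h1 : Tendsto (fun T : ℕ => R' / (T : ℝ) ^ (1 / 3 : ℝ)) atTop (𝓝 0) :=
    hT.const_div_atTop R'
  suffices h2 : Tendsto (fun T : ℕ => decaySum β
      ⌊L * ((T : ℝ) ^ (1 / 3 : ℝ) / (N : ℝ) ^ (1 / 3 : ℝ))⌋₊ /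
        ((T : ℝ) ^ (1 / 3 : ℝ) / (N : ℝ) ^ (1 / 3 : ℝ))) atTop (𝓝 0) by
    have h3 := h1.add (h2.const_mul R)
    rw [mul_zero, add_zero] at h3
    exact h3
  -- For `N = 0` division by zero makes the quotient identically 0.
  rcases Nat.eq_zero_or_pos N with rfl | hN
  · simp
  · have hc : 0 < (N : ℝ) ^ (1 / 3 : ℝ) := Real.rpow_pos_of_pos (by exact_mod_cast hN) _
    have hθ := hT.atTop_div_const hc
    have hm : Tendsto (fun T : ℕ => ⌊L * ((T : ℝ) ^ (1 / 3 : ℝ) / (N : ℝ) ^ (1 / 3 : ℝ))⌋₊)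
        atTop atTop := tendsto_nat_floor_atTop.comp (hθ.const_mul_atTop (by linarith))
    have h3 := ((hβ.2.2.cesaro.comp hm).const_mul L)
    rw [mul_zero] at h3
    refine squeeze_zero' ?_ ?_ h3
    · refine Eventually.of_forall fun T => ?_
      have := decaySum_nonneg hβ ⌊L * ((T : ℝ) ^ (1 / 3 : ℝ) / (N : ℝ) ^ (1 / 3 : ℝ))⌋₊
      positivity
    · filter_upwards [hθ.eventually_ge_atTop 1] with T hT1
      change _ ≤ L * ((⌊L * ((T : ℝ) ^ (1 / 3 : ℝ) / (N : ℝ) ^ (1 / 3 : ℝ))⌋₊ : ℝ)⁻¹ *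
        decaySum β ⌊L * ((T : ℝ) ^ (1 / 3 : ℝ) / (N : ℝ) ^ (1 / 3 : ℝ))⌋₊)
      generalize (T : ℝ) ^ (1 / 3 : ℝ) / (N : ℝ) ^ (1 / 3 : ℝ) = θ at *
      have h4 : 0 < ⌊L * θ⌋₊ := Nat.floor_pos.2 (one_le_mul_of_one_le_of_one_le hL hT1)
      have h5 : (⌊L * θ⌋₊ : ℝ) ≤ L * θ := Nat.floor_le (by positivity)
      have h6 := decaySum_nonneg hβ ⌊L * θ⌋₊
      have h7 : (0 : ℝ) < ⌊L * θ⌋₊ := by exact_mod_cast h4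
      rw [div_le_iff₀ (by linarith), ← div_eq_inv_mul, mul_assoc, div_mul_eq_mul_div,
        mul_div_assoc', le_div_iff₀ h7]
      calc _ ≤ decaySum β ⌊L * θ⌋₊ * (L * θ) := by gcongr
        _ = _ := by ring

end Asymptotics

end DBAR

/-! ### Assembly of the two regret bounds -/

theorem mainTheorem5
    (Lf f0 Lc1 Lc2 c0max Lctrl ctrl0max wmax γ r0 α0 δ ν ζ ηlo ηhi CH : ℝ) (β : ℕ → ℝ)
    (hLf : 1 ≤ Lf) (hLc1 : 0 < Lc1) (hLc2 : 0 < Lc2) (hc0max : 0 ≤ c0max)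
    (hctrl0max : 0 ≤ ctrl0max) (hwmax : 0 < wmax) (hγ : 0 < γ) (hr0 : 0 < r0)
    (hβ : DBAR.IsDecayRate β) (hα0 : β 0 < α0) (hν : 0 < ν) (hηlo : 0 < ηlo) :
    ∃ (C : ℝ) (p : ℕ) (ε : ℕ → ℕ → ℝ), 0 < C ∧ (∀ N, Tendsto (ε N) atTop (𝓝 0)) ∧
      ∀ (n m g N T : ℕ) (S : DBAR.Problem n m g N) (A : DBAR.Input N) (z : ℝ) (istar : Fin N)
        (Ω : Type*) [MeasurableSpace Ω] (P : Measure Ω) [IsProbabilityMeasure P]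
        (K : ℕ → Ω → Fin N),
        -- the control problem
        S.wmax = wmax → ‖S.x0‖ = r0 → S.BoundedNoise → S.DynamicsAssumption Lf f0 →
        S.CostAssumption Lc1 Lc2 c0max → S.PoolAssumption Lctrl ctrl0max →
        S.IsBestStabilizing β γ T istar →
        -- the inputs of the algorithm
        A.β = β → A.γ = γ → A.α0 = α0 → A.δ = δ → A.ValidPick ‖S.x0‖ → A.y = 1 / 2 →
        0 < z → z ≤ ζ * N →
        A.τ = DBAR.polyBatch (1 / (N : ℝ) ^ (1 / 2 : ℝ)) z (1 / 2) ν →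
        0 < A.τ 0 → (A.τ 1 : ℝ) / A.τ 0 * β (A.τ 0) ^ 2 < 1 / (2 * √2) →
        γ * wmax / (1 - β (A.τ 0)) ≤ δ →
        ηlo / ((T : ℝ) ^ (2 / 3 : ℝ) * (N : ℝ) ^ (1 / 3 : ℝ)) ≤ A.η0 →
        A.η0 ≤ ηhi / ((T : ℝ) ^ (2 / 3 : ℝ) * (N : ℝ) ^ (1 / 3 : ℝ)) →
        -- the horizon
        max (((S.destabilizing β γ).ncard : ℝ) ^ (3 / 2 : ℝ) /
            ((N : ℝ) ^ (1 / 2 : ℝ) * ((S.destabilizing β γ).ncard + 1 : ℝ) ^ (3 / 4 : ℝ)))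
          (N : ℝ) ≤ T →
        -- the controllers are sampled as the algorithm prescribes
        DBAR.IsSampled S A P K →
        -- general decay
        (DBAR.regret S A P K T istar ≤
          C * (1 + Real.log T) ^ p * ((T : ℝ) ^ (2 / 3 : ℝ) * (N : ℝ) ^ (1 / 3 : ℝ) *
              ((S.destabilizing β γ).ncard + 1 : ℝ) ^ (1 / 2 : ℝ))
            + ε N T * Real.exp (C * (S.destabilizing β γ).ncard) *
              ((S.destabilizing β γ).ncard + 1 : ℝ) ^ (1 / 2 : ℝ)
            + ε N T * T) ∧
        -- logarithmic growth of the partial sums of the decay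
        ((∀ t, 1 ≤ t → DBAR.decaySum β t ≤ CH * ∑ i ∈ Finset.Icc 1 t, (1 / (i : ℝ))) →
          DBAR.regret S A P K T istar ≤
            (C * (1 + Real.log T) ^ p * (T : ℝ) ^ (2 / 3 : ℝ)
              + C * (1 + Real.log T) ^ p * (T : ℝ) ^ (-(1 / 3) : ℝ) *
                Real.exp (C * (S.destabilizing β γ).ncard)) *
            (N : ℝ) ^ (1 / 3 : ℝ) * ((S.destabilizing β γ).ncard + 1 : ℝ) ^ (1 / 2 : ℝ)) := by
  have hM : 0 ≤ 1 + |Lctrl| + ctrl0max := by positivity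
  set G := DBAR.tameConst Lf f0 Lc1 Lc2 c0max (1 + |Lctrl| + ctrl0max) wmax γ r0 δ
  have hG : 1 ≤ G := DBAR.one_le_tameConst (by linarith) hLc1.le hLc2.le hc0max hM hwmax.le
    hγ.le hr0.le
  set L := DBAR.lengthConst ν ζ
  have hL : 1 ≤ L := DBAR.one_le_lengthConst ν ζ
  set R := DBAR.regretConst G ν ζ ηlo ηhi
  have hR : 0 ≤ R := DBAR.regretConst_nonneg hG hν hηlo
  set e := 5 * Real.log (3 * G ^ 2) with he
  have he0 : 0 ≤ e := mul_nonneg (by norm_num) (Real.log_nonneg (by nlinarith))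
  set X := (2 * G) ^ 5 with hX
  have hX0 : 0 ≤ X := by positivity
  have hlL : 0 ≤ Real.log L := Real.log_nonneg hL
  -- `3 e` covers the cubed exponential, `R (1 + X)` the leading term, `R X` the factor of `T^{-1/3}
  -- e^{C U}`, and the last summand the logarithmic bound on `H`.
  set C := 1 + 3 * e + R * (1 + X) + R * X + R * (|CH| * (1 + Real.log L)) with hC
  have c1 : 0 ≤ R * (1 + X) := by positivity
  have c2 : 0 ≤ R * X := by positivity
  have c3 : 0 ≤ R * (|CH| * (1 + Real.log L)) := by positivity
  have hC0 : 0 < C := by linarith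
  refine ⟨C, 1, DBAR.errorTerm β L R (R * X), hC0,
    DBAR.tendsto_errorTerm hβ hL R (R * X), ?_⟩
  intro n m g N T S A z istar Ω _ P _ K hSw hS0 hnoise hdyn hcost hpool hbest hAβ hAγ hAα hAδ
    hpick hy hz hzζ hτ hτ0 hratio hδ h1 h2 hT hK
  have hN : 1 ≤ N := istar.pos
  have hNT : N ≤ T := by exact_mod_cast (le_max_right _ _).trans hT
  have hN' : (1 : ℝ) ≤ N := by exact_mod_cast hN
  have hNT' : (N : ℝ) ≤ T := by exact_mod_cast hNT
  have hT0 : (0 : ℝ) ≤ T := Nat.cast_nonneg T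
  have hN0 : (0 : ℝ) < N := by linarith
  have hT1 : (0 : ℝ) < T := by linarith
  have hη : 0 < A.η0 := lt_of_lt_of_le (by positivity) h1
  have hmono : Monotone A.τ := hτ ▸ DBAR.polyBatch_sqrt_mono hν
  have hTame := DBAR.tame_of_assumptions hLf hLc1 hLc2 hc0max hctrl0max hwmax hγ hr0 hβ hα0 hSw hS0
    hnoise hdyn hcost hpool hbest.1 hAβ hAγ hAα hAδ hpick hy hmono hτ0 hratio hδ hη
  have hpow : (T : ℝ) ^ (2 / 3 : ℝ) = ((T : ℝ) ^ (1 / 3 : ℝ)) ^ 2 := by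
    rw [← Real.rpow_natCast, ← Real.rpow_mul hT0]
    norm_num
  have ha3 : ((T : ℝ) ^ (1 / 3 : ℝ)) ^ 3 = T := by
    rw [← Real.rpow_natCast, ← Real.rpow_mul hT0]
    norm_num
  rw [hpow] at h1 h2
  set U := (S.destabilizing β γ).ncard with hU
  have hreg := hTame.regret_le_horizon hK (U := U) (by rw [hU, hAβ, hAγ]) hν hz hzζ hηlo hτ hNT h1 h2
  have hc1 : 1 ≤ (N : ℝ) ^ (1 / 3 : ℝ) := Real.one_le_rpow hN' (by norm_num)
  have hca : (N : ℝ) ^ (1 / 3 : ℝ) ≤ (T : ℝ) ^ (1 / 3 : ℝ) :=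
    Real.rpow_le_rpow (by linarith) hNT' (by norm_num)
  have haT : (T : ℝ) ^ (1 / 3 : ℝ) ≤ T := by
    conv_rhs => rw [← Real.rpow_one (T : ℝ)]
    exact Real.rpow_le_rpow_of_exponent_le (hN'.trans hNT') (by norm_num)
  have hu1 : 1 ≤ ((U : ℝ) + 1) ^ (1 / 2 : ℝ) :=
    Real.one_le_rpow (by linarith [(Nat.cast_nonneg U : (0 : ℝ) ≤ U)]) (by norm_num)
  have hlT : 0 ≤ Real.log T := Real.log_nonneg (hN'.trans hNT')
  have hdlog : (∀ t, 1 ≤ t → DBAR.decaySum β t ≤ CH * ∑ i ∈ Finset.Icc 1 t, (1 / (i : ℝ))) →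
      DBAR.decaySum β ⌊L * ((T : ℝ) ^ (1 / 3 : ℝ) / (N : ℝ) ^ (1 / 3 : ℝ))⌋₊ ≤
        |CH| * (1 + Real.log L) * (1 + Real.log T) := fun hH =>
    DBAR.decaySum_le_log hH hL ((one_le_div (by linarith)).2 hca)
      ((div_le_self (by linarith) hc1).trans haT)
  have hd0 := DBAR.decaySum_nonneg hβ
    ⌊L * ((T : ℝ) ^ (1 / 3 : ℝ) / (N : ℝ) ^ (1 / 3 : ℝ))⌋₊
  rw [DBAR.stateBound_pow_five hG, ← he, ← hX, hAβ] at hreg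
  rw [hpow, Real.rpow_neg hT0, pow_one, DBAR.errorTerm]
  have hexp : Real.exp (e * U) ^ 3 ≤ Real.exp (C * U) := by
    rw [← Real.exp_nat_mul]
    refine Real.exp_le_exp.2 ?_
    push_cast
    rw [← mul_assoc]
    gcongr
    linarith
  set d := DBAR.decaySum β ⌊L * ((T : ℝ) ^ (1 / 3 : ℝ) / (N : ℝ) ^ (1 / 3 : ℝ))⌋₊
  generalize ((U : ℝ) + 1) ^ (1 / 2 : ℝ) = u at *
  generalize (T : ℝ) ^ (1 / 3 : ℝ) = a at *
  generalize (N : ℝ) ^ (1 / 3 : ℝ) = c at *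
  generalize DBAR.regret S A P K T istar = r at *
  set E := Real.exp (C * U)
  have hE1 : 0 < E := Real.exp_pos _
  have ha1 : 1 ≤ a := hc1.trans hca
  -- Here `a = T^{1/3}`, `c = N^{1/3}`, `u = √(U+1)`; the cube `x³` is absorbed by `E = e^{C U}`.
  have hkey : Real.exp (e * U) * a ≤ a ^ 2 * c + E / a := by
    refine (DBAR.mul_le_sq_add_cube_div (Real.exp_pos _).le (by linarith)).trans ?_
    gcongr
    exact le_mul_of_one_le_right (by positivity) hc1
  have hreg' : r ≤ R * (1 + X) * ((1 + Real.log T) * (a ^ 2 * c) * u) + R * X * (E / a) * u +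
      R * (a ^ 2 * c * d) := by
    refine hreg.trans ?_
    have h3 : X * Real.exp (e * U) * a * u ≤ X * ((1 + Real.log T) * (a ^ 2 * c) + E / a) * u := by
      rw [mul_assoc X]
      have : 0 ≤ Real.log T * (a ^ 2 * c) := by positivity
      gcongr
      linarith
    have h4 := mul_le_mul_of_nonneg_left h3 hR
    linarith
  have hC1 : R * (1 + X) * ((1 + Real.log T) * (a ^ 2 * c) * u) ≤
      C * ((1 + Real.log T) * (a ^ 2 * c) * u) := by
    gcongr
    linarith
  constructor
  · have h3 : R * (d / (a / c)) * T = R * (a ^ 2 * c * d) := by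
      rw [← ha3]
      field_simp
    have h4 : 0 ≤ R * X / a * T := by positivity
    have h5 : 0 ≤ R * (d / (a / c)) * E * u := by positivity
    have h6 : R * X * (E / a) * u = R * X / a * E * u := by ring
    linarith
  · intro hH
    have h3 : R * (a ^ 2 * c * d) ≤
        R * (|CH| * (1 + Real.log L)) * ((1 + Real.log T) * (a ^ 2 * c) * u) := by
      calc R * (a ^ 2 * c * d)
          ≤ R * (a ^ 2 * c * (|CH| * (1 + Real.log L) * (1 + Real.log T))) := by
            gcongr
            exact hdlog hH
        _ ≤ R * (a ^ 2 * c * (|CH| * (1 + Real.log L) * (1 + Real.log T))) * u :=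
            le_mul_of_one_le_right (by positivity) hu1
        _ = _ := by ring
    have h4 : (R * (1 + X) + R * (|CH| * (1 + Real.log L))) *
        ((1 + Real.log T) * (a ^ 2 * c) * u) ≤ C * ((1 + Real.log T) * (a ^ 2 * c) * u) := by
      gcongr
      linarith
    have h5 : R * X * (E / a) * u ≤ C * (1 + Real.log T) * a⁻¹ * E * c * u := by
      have h6 : R * X ≤ C * (1 + Real.log T) := by
        have := mul_nonneg hC0.le hlT
        linarith
      calc R * X * (E / a) * u ≤ R * X * (E / a) * u * c :=
            le_mul_of_one_le_right (by positivity) hc1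
        _ = R * X * (a⁻¹ * E * c * u) := by ring
        _ ≤ C * (1 + Real.log T) * (a⁻¹ * E * c * u) := by gcongr
        _ = _ := by ring
    linarith
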